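/- Throughout, $\mathbf F_q$ is a finite field of odd characteristic $p$, $\chi(x)=e^{2\pi i\,\mathrm{Tr}(x)/p}$ is its canonical additive character, $x\cdot y=\sum_j x_jy_j$ on $\mathbf F_q^d$, and $\mathbf E_x$ denotes the average over $x\in\mathbf F_q^d$. For $\lambda\in\mathbf F_q^*$ let $S=\{x\in\mathbf F_q^d: x\cdot x=\lambda\}$ and $\sigma=q1_S$. For real-valued functions on $\mathbf F_q^d$ put $f*g(x)=\mathbf E_y f(y)g(x-y)$, $$\|f\|_{U^2_\perp(S)}=\Big(\mathbf E_{x}\mathbf E_{h}\mathbf E_{h'}\, f\sigma(x)\,f\sigma(x+h)\,f\sigma(x+h')\,f\sigma(x+h+h')\Big)^{1/4},\qquad \|f\|_{L^2(S)}=\Big(\mathbf E_x |f(x)|^2\sigma(x)\Big)^{1/2}.$$ For $\Gamma\subseteq\mathbf F_q^d$ and real $\rho$ let $B(\Gamma,\rho)=\{x\in\mathbf F_q^d: |\chi(\xi\cdot x)-1|\le\rho\text{ for all }\xi\in\Gamma\}$. The Bohr set $B(\Gamma,\rho)$ is regular if for all $\epsilon>0$ with $100\,\epsilon|\Gamma|\le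 1$, $$|B(\Gamma,(1+\epsilon)\rho)|\le(1+100\epsilon|\Gamma|)|B(\Gamma,\rho)|\quad\text{and}\quad |B(\Gamma,(1-\epsilon)\rho)|\ge(1-100\epsilon|\Gamma|)|B(\Gamma,\rho)|.$$ For $B=B(\Gamma,\rho)$ let $\mu_B=\frac{q^d}{|B|}1_B$ and $\nu_B=\mu_B*\mu_B*\mu_B*\mu_B$. **Proposition (arithmetic regularity lemma).** Let $\eta\in(0,1)$ and let $\varphi:(0,1]^2\to(0,1)$ be increasing (not necessarily strictly) in both coordinates. There are constants $C$, $c>0$ and $q_0$, depending only on $\eta$ and $\varphi$, such that for every finite field $\mathbf F_q$ of odd characteristic with $q\ge q_0$, every $d\ge 4$, every $\lambda\in\mathbf F_q^*$ and every $f:\mathbf F_q^d\to[-1,1]$ the following holds. There exist a nonempty $\Gamma\subseteq\mathbf F_q^d$ with $|\Gamma|\le C$ and $\rho\in(0,1]$ with $\rho\ge c$ such that $B=B(\Gamma,\rho)$ is regular, and functions $f_1,f_2,f_3:\mathbf F_q^d\to[-2,2]$ such that $$f=f_1+f_2+f_3,\qquad f_1=\nu_B*(f\sigma),\qquad \|f_2\|_{U^2_\perp(S)}\le\varphi(|\Gamma|^{-1},\rho),\qquad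 \|f_3\|_{L^2(S)}\le\eta.$$ -/

import Mathlib

open scoped BigOperators

namespace SphereRegularity

/-- The canonical additive character `χ(x) = exp (2 π i Tr(x) / p)` of a finite field of
characteristic `p`, where `Tr` is the trace to the prime field. -/
noncomputable def canonicalChar (F : Type*) [Field F] [Fintype F] : AddChar F ℂ :=
  letI : Algebra (ZMod (ringChar F)) F := ZMod.algebra F (ringChar F)
  haveI : NeZero (ringChar F) := ⟨CharP.char_ne_zero_of_finite F (ringChar F)⟩
  (ZMod.stdAddChar (N := ringChar F)).compAddMonoidHom
    (Algebra.trace (ZMod (ringChar F)) F).toAddMonoidHom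

open Classical in
/-- The normalized indicator function `q 1_S` of the sphere `S = {x | x · x = lam}`. -/
noncomputable def sphereMeasure {F : Type*} [Field F] [Fintype F] {d : ℕ} (lam : F)
    (x : Fin d → F) : ℝ :=
  if x ⬝ᵥ x = lam then (Fintype.card F : ℝ) else 0

/-- The normalized convolution `(f * g)(x) = 𝔼 y, f(y) g(x - y)`. -/
noncomputable def convolve {F : Type*} [Field F] [Fintype F] {d : ℕ}
    (f g : (Fin d → F) → ℝ) (x : Fin d → F) : ℝ :=
  𝔼 y : Fin d → F, f y * g (x - y)

open Classical in
/-- The Bohr set with spectrum `Γ` and radius `ρ`. -/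
noncomputable def bohr {F : Type*} [Field F] [Fintype F] {d : ℕ}
    (Γ : Finset (Fin d → F)) (ρ : ℝ) : Finset (Fin d → F) :=
  {x : Fin d → F | ∀ ξ ∈ Γ, ‖canonicalChar F (ξ ⬝ᵥ x) - 1‖ ≤ ρ}

/-- Regularity of the Bohr set `B(Γ, ρ)` in the sense of Bourgain. -/
def IsRegular {F : Type*} [Field F] [Fintype F] {d : ℕ}
    (Γ : Finset (Fin d → F)) (ρ : ℝ) : Prop :=
  ∀ ε : ℝ, 0 < ε → 100 * ε * (Γ.card : ℝ) ≤ 1 →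
    ((bohr Γ ((1 + ε) * ρ)).card : ℝ) ≤ (1 + 100 * ε * (Γ.card : ℝ)) * ((bohr Γ ρ).card : ℝ) ∧
    (1 - 100 * ε * (Γ.card : ℝ)) * ((bohr Γ ρ).card : ℝ) ≤ ((bohr Γ ((1 - ε) * ρ)).card : ℝ)

open Classical in
/-- The normalized indicator function `μ_B = (q ^ d / |B|) 1_B`. -/
noncomputable def mu {F : Type*} [Field F] [Fintype F] {d : ℕ}
    (B : Finset (Fin d → F)) (x : Fin d → F) : ℝ :=
  if x ∈ B then (Fintype.card F : ℝ) ^ d / (B.card : ℝ) else 0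

/-- The fourfold convolution `ν_B = μ_B * μ_B * μ_B * μ_B`. -/
noncomputable def nu {F : Type*} [Field F] [Fintype F] {d : ℕ}
    (B : Finset (Fin d → F)) : (Fin d → F) → ℝ :=
  convolve (convolve (convolve (mu B) (mu B)) (mu B)) (mu B)

/-- The `U²_⊥(S)` norm of a real-valued function `f`, where `S` is the sphere `x · x = lam`:
the Gowers `U²` norm of `f σ`. -/
noncomputable def uPerpNorm {F : Type*} [Field F] [Fintype F] {d : ℕ} (lam : F)
    (f : (Fin d → F) → ℝ) : ℝ :=
  (𝔼 x : Fin d → F, 𝔼 h : Fin d → F, 𝔼 h' : Fin d → F,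
    (f x * sphereMeasure lam x) * (f (x + h) * sphereMeasure lam (x + h)) *
    (f (x + h') * sphereMeasure lam (x + h')) *
    (f (x + h + h') * sphereMeasure lam (x + h + h'))) ^ (1 / 4 : ℝ)

/-- The `L²(S)` norm of a real-valued function `f`, where `S` is the sphere `x · x = lam`. -/
noncomputable def l2SphereNorm {F : Type*} [Field F] [Fintype F] {d : ℕ} (lam : F)
    (f : (Fin d → F) → ℝ) : ℝ :=
  Real.sqrt (𝔼 x : Fin d → F, f x ^ 2 * sphereMeasure lam x)

end SphereRegularity

open SphereRegularity

/-!
# An arithmetic regularity lemma for functions on a sphere over a finite field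

The normalized sphere measure `σ = q 1_S` is pseudorandom: every Fourier coefficient of `σ - 1` is
`O(q ^ (-5/4))`. In dimension at least five this follows from the size of the Gauss sums alone. In
dimension four that only gives `1 / q`, which just fails to suffice; there the Fourier coefficients
are Kloosterman sums, and their fourth moment supplies the missing power
(`norm_ft_sphereMeasure_sub_one_pow_four_le`).

Any nonnegative weight with `ft (σ - 1)` of size at most `κ` satisfies a dual restriction estimate,
`IsPseudorandom.sum_mul_normSq_ft_le`: with a weight `w` valued in `[0, 1]`, the sum of
`w |ft (f σ)| ^ 2` is bounded as long as `κ ∑ w` is. Three consequences carry the argument. The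
large spectrum of `f σ` is bounded; the energy `∑ ν̂_B |ft (f σ)| ^ 2` of a Bohr set is bounded; and
the `ℓ⁴` norm of `ft (f σ)`, which is the `U²` norm of `f σ`, is controlled by the supremum of
`ft (f σ)` once `κ q` is small (`IsPseudorandom.sum_ft_pow_four_le`). Only the last one needs
`κ = o(1 / q)`, because frequencies with very small coefficients are handled by Parseval, at the
cost of a factor `q`.

Starting from `Γ = {0}`, one builds regular Bohr sets `B_i`, the spectrum of each containing the
large spectrum of `f σ` and the large coefficients of its predecessor, at levels dictated by the
growth function (`IsPseudorandom.exists_bohr_sequence`). Regular radii come from Vitali's covering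
lemma (`exists_isRegular`). The energies are bounded and nearly increasing, so that two consecutive
functions `ν_{B_i} * (f σ)` and `ν_{B_{i+1}} * (f σ)` are close in `L²(S)`
(`IsPseudorandom.exists_small_increment`). The first is `f₁`, the difference is essentially `f₃`,
and `f₂` is what remains of `f`; it is uniform since `B_{i+1}` resolves the large spectrum of `f σ`
(`IsPseudorandom.exists_decomposition`). As `q` is large, smoothing by `ν_B` gives functions bounded
by `1 + s / 2` with `s` tiny, and the factor `1 - s` put on the second one restores the bound `2`
for all three parts.
-/

namespace SphereRegularity

open Finset ComplexConjugate

variable {F : Type*} [Field F] [Fintype F] {d : ℕ}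

/-! ### The canonical character and Fourier analysis on `F ^ d` -/

lemma canonicalChar_isPrimitive : (canonicalChar F).IsPrimitive := by
  apply AddChar.IsPrimitive.of_ne_one
  let _ : Algebra (ZMod (ringChar F)) F := ZMod.algebra F (ringChar F)
  have : NeZero (ringChar F) := ⟨CharP.char_ne_zero_of_finite F (ringChar F)⟩
  obtain ⟨b, hb⟩ := FiniteField.trace_to_zmod_nondegenerate F (one_ne_zero (α := F))
  rw [AddChar.ne_one_iff]
  refine ⟨1 * b, fun h => hb ?_⟩
  apply ZMod.injective_stdAddChar
  rw [AddChar.map_zero_eq_one]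
  exact h

/-- The character `x ↦ χ(ξ · x)` of `F ^ d`. -/
noncomputable def ch (ξ x : Fin d → F) : ℂ := canonicalChar F (ξ ⬝ᵥ x)

lemma ch_comm (ξ x : Fin d → F) : ch ξ x = ch x ξ := by
  simp [ch, dotProduct_comm]

lemma ch_add_right (ξ x y : Fin d → F) : ch ξ (x + y) = ch ξ x * ch ξ y := by
  simp [ch, dotProduct_add, AddChar.map_add_eq_mul]

lemma ch_add_left (ξ ζ x : Fin d → F) : ch (ξ + ζ) x = ch ξ x * ch ζ x := by
  simp [ch, add_dotProduct, AddChar.map_add_eq_mul]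

@[simp] lemma norm_canonicalChar (t : F) : ‖canonicalChar F t‖ = 1 := AddChar.norm_apply _ _

@[simp] lemma norm_ch (ξ x : Fin d → F) : ‖ch ξ x‖ = 1 := norm_canonicalChar _

@[simp] lemma ch_zero_left (x : Fin d → F) : ch 0 x = 1 := by simp [ch]

@[simp] lemma ch_zero_right (x : Fin d → F) : ch x 0 = 1 := by simp [ch]

lemma canonicalChar_neg (t : F) : canonicalChar F (-t) = conj (canonicalChar F t) :=
  AddChar.map_neg_eq_conj _ _

lemma ch_neg_right (ξ x : Fin d → F) : ch ξ (-x) = conj (ch ξ x) := by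
  simp [ch, canonicalChar_neg]

lemma ch_neg_left (ξ x : Fin d → F) : ch (-ξ) x = conj (ch ξ x) := by
  simp [ch, canonicalChar_neg]

lemma ch_sub_left (ξ ζ x : Fin d → F) : ch (ξ - ζ) x = ch ξ x * conj (ch ζ x) := by
  rw [sub_eq_add_neg, ch_add_left, ch_neg_left]

lemma ch_sub_right (ξ x y : Fin d → F) : ch ξ (x - y) = ch ξ x * conj (ch ξ y) := by
  rw [sub_eq_add_neg, ch_add_right, ch_neg_right]

open Classical in
lemma expect_ch (ξ : Fin d → F) : 𝔼 x, ch ξ x = if ξ = 0 then 1 else 0 := by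
  let ψ : AddChar (Fin d → F) ℂ :=
    { toFun := ch ξ
      map_zero_eq_one' := ch_zero_right ξ
      map_add_eq_mul' := ch_add_right ξ }
  have h : 𝔼 x, ψ x = if ψ = 0 then 1 else 0 := AddChar.expect_eq_ite ψ
  have hψ : ψ = 0 ↔ ξ = 0 := by
    constructor
    · intro h0
      by_contra hξ
      obtain ⟨i, hi⟩ := Function.ne_iff.mp hξ
      apply canonicalChar_isPrimitive (F := F) hi
      rw [AddChar.eq_one_iff]
      intro t
      have := DFunLike.congr_fun h0 (Pi.single i t)
      simpa [ψ, ch] using this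
    · rintro rfl
      rw [AddChar.eq_zero_iff]
      exact fun x => ch_zero_left x
  simp only [hψ] at h
  exact h

open Classical in
lemma sum_ch (ξ : Fin d → F) :
    ∑ x, ch ξ x = if ξ = 0 then (Fintype.card (Fin d → F) : ℂ) else 0 := by
  rw [← Fintype.card_mul_expect, expect_ch]
  simp

/-- The Fourier transform of a real function, normalized as an average. -/
noncomputable def ft (g : (Fin d → F) → ℝ) (ξ : Fin d → F) : ℂ :=
  𝔼 x, (g x : ℂ) * conj (ch ξ x)

/-- The function with Fourier coefficients `a`. -/
noncomputable def synth (a : (Fin d → F) → ℂ) (x : Fin d → F) : ℂ := ∑ ξ, a ξ * ch ξ x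

lemma synth_ft (g : (Fin d → F) → ℝ) (x : Fin d → F) : synth (ft g) x = g x := by
  classical
  have h : ∀ y, (∑ ξ, conj (ch ξ y) * ch ξ x)
      = if x = y then (Fintype.card (Fin d → F) : ℂ) else 0 := by
    intro y
    have := sum_ch (x - y)
    simp only [sub_eq_zero] at this
    rw [← this]
    refine sum_congr rfl fun ξ _ => ?_
    rw [ch_sub_left, ch_comm x, ch_comm y, mul_comm]
  simp only [synth, ft, expect_mul, ← expect_sum_comm, mul_assoc, ← mul_sum, h]
  simp [expect_eq_sum_div_card]

lemma synth_sub (a b : (Fin d → F) → ℂ) (x) : synth (a - b) x = synth a x - synth b x := by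
  simp [synth, sub_mul, sum_sub_distrib]

open Classical in
lemma synth_single (ξ x : Fin d → F) : synth (Pi.single ξ 1) x = ch ξ x := by
  simp [synth, Pi.single_apply]

open Classical in
lemma expect_synth_mul_conj_ch (a : (Fin d → F) → ℂ) (ξ : Fin d → F) :
    𝔼 x, synth a x * conj (ch ξ x) = a ξ := by
  simp only [synth, sum_mul, expect_sum_comm, mul_assoc, ← mul_expect, ← ch_sub_left, expect_ch]
  simp [sub_eq_zero]

lemma ft_eq_of_synth {g : (Fin d → F) → ℝ} {a : (Fin d → F) → ℂ} (h : ∀ x, (g x : ℂ) = synth a x) :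
    ft g = a := by
  ext ξ
  simp only [ft, h, expect_synth_mul_conj_ch]

lemma conj_expect {ι : Type*} (s : Finset ι) (f : ι → ℂ) :
    conj (𝔼 i ∈ s, f i) = 𝔼 i ∈ s, conj (f i) := by
  simp [expect_eq_sum_div_card]

lemma norm_expect_le {ι : Type*} (s : Finset ι) (f : ι → ℂ) :
    ‖𝔼 i ∈ s, f i‖ ≤ 𝔼 i ∈ s, ‖f i‖ := by
  simp only [expect_eq_sum_div_card, norm_div, Complex.norm_natCast]
  gcongr
  exact norm_sum_le _ _

/-- Parseval's identity, for one real function and one trigonometric sum. -/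
lemma expect_mul_conj_synth (g : (Fin d → F) → ℝ) (a : (Fin d → F) → ℂ) :
    𝔼 x, (g x : ℂ) * conj (synth a x) = ∑ ξ, ft g ξ * conj (a ξ) := by
  simp only [synth, map_sum, map_mul, mul_sum, expect_sum_comm, ft, expect_mul]
  refine sum_congr rfl fun ξ _ => expect_congr rfl fun x _ => by ring

lemma expect_normSq_synth (a : (Fin d → F) → ℂ) :
    𝔼 x, ‖synth a x‖ ^ 2 = ∑ ξ, ‖a ξ‖ ^ 2 := by
  have : (𝔼 x, synth a x * conj (synth a x)) = ∑ ξ, a ξ * conj (a ξ) := by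
    conv_lhs =>
      enter [2, x, 2]
      rw [synth, map_sum]
    simp only [mul_sum, expect_sum_comm]
    refine sum_congr rfl fun ξ _ => ?_
    nth_rw 2 [← expect_synth_mul_conj_ch a ξ]
    rw [expect_mul]
    refine expect_congr rfl fun x _ => ?_
    rw [map_mul]
    ring
  simp only [RCLike.mul_conj] at this
  apply Complex.ofReal_injective
  rw [Complex.ofReal_expect]
  push_cast
  exact this

lemma sum_normSq_ft (g : (Fin d → F) → ℝ) : ∑ ξ, ‖ft g ξ‖ ^ 2 = 𝔼 x, g x ^ 2 := by
  rw [← expect_normSq_synth]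
  simp [synth_ft]

lemma ft_convolve (g h : (Fin d → F) → ℝ) : ft (convolve g h) = ft g * ft h := by
  ext ξ
  simp only [ft, convolve, Pi.mul_apply, Complex.ofReal_expect, expect_mul]
  rw [expect_comm]
  refine expect_congr rfl fun y _ => ?_
  rw [mul_expect]
  refine (Fintype.expect_equiv (Equiv.addRight y) _ _ fun x => ?_).symm
  simp [ch_add_right]
  ring

lemma convolve_eq_synth (g h : (Fin d → F) → ℝ) (x : Fin d → F) :
    (convolve g h x : ℂ) = synth (fun ξ => ft g ξ * ft h ξ) x := by
  rw [← synth_ft, ft_convolve]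
  rfl

lemma norm_ft_le (g : (Fin d → F) → ℝ) (ξ : Fin d → F) : ‖ft g ξ‖ ≤ 𝔼 x, |g x| := by
  refine (norm_expect_le _ _).trans (le_of_eq ?_)
  simp

lemma ft_sub (g h : (Fin d → F) → ℝ) : ft (g - h) = ft g - ft h := by
  ext ξ
  simp [ft, sub_mul, expect_sub_distrib]

lemma ft_add (g h : (Fin d → F) → ℝ) : ft (g + h) = ft g + ft h := by
  ext ξ
  simp [ft, add_mul, expect_add_distrib]

lemma ft_smul (c : ℝ) (g : (Fin d → F) → ℝ) : ft (c • g) = (c : ℂ) • ft g := by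
  ext ξ
  simp [ft, mul_expect, mul_assoc]

/-- The fourth power of the Gowers `U²` norm is the `ℓ⁴` norm of the Fourier transform. -/
lemma expect_box_eq_sum_ft_pow_four (g : (Fin d → F) → ℝ) :
    (𝔼 x, 𝔼 h, 𝔼 h', g x * g (x + h) * g (x + h') * g (x + h + h')) = ∑ ξ, ‖ft g ξ‖ ^ 4 := by
  -- for fixed `h`, the average over `x` and `h'` is the square of the autocorrelation at `h`
  let r : (Fin d → F) → ℝ := fun h => 𝔼 x, g x * g (x + h)
  have hr : ∀ ξ, ft r ξ = ((‖ft g ξ‖ ^ 2 : ℝ) : ℂ) := by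
    intro ξ
    have h1 : ((‖ft g ξ‖ ^ 2 : ℝ) : ℂ) = conj (ft g ξ) * ft g ξ := by
      rw [RCLike.conj_mul]; push_cast; rfl
    rw [h1]
    nth_rw 2 [ft]
    rw [ft, conj_expect, expect_mul]
    simp only [ft, r, Complex.ofReal_expect, expect_mul]
    rw [expect_comm]
    refine expect_congr rfl fun y _ => ?_
    rw [mul_expect]
    refine Fintype.expect_equiv (Equiv.addLeft y) _ _ fun x => ?_
    have : ch ξ y * conj (ch ξ y) = 1 := by rw [RCLike.mul_conj]; simp
    simp [ch_add_right]
    linear_combination (-(g y : ℂ) * g (y + x) * conj (ch ξ x)) * this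
  have h2 := sum_normSq_ft r
  simp only [hr, Complex.norm_real, norm_pow, norm_norm, ← pow_mul] at h2
  rw [h2, expect_comm]
  refine expect_congr rfl fun h _ => ?_
  rw [sq, expect_mul_expect]
  refine expect_congr rfl fun x _ => ?_
  refine Fintype.expect_equiv (Equiv.addLeft x) _ _ fun y => ?_
  simp only [Equiv.coe_addLeft]
  rw [add_right_comm x h y]
  ring

/-! ### Restriction estimates for pseudorandom weights -/

/-- A nonnegative weight all of whose Fourier coefficients are within `κ` of those of the constant
function `1`. -/
def IsPseudorandom (σ : (Fin d → F) → ℝ) (κ : ℝ) : Prop :=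
  (∀ x, 0 ≤ σ x) ∧ ∀ ξ, ‖ft (σ - 1) ξ‖ ≤ κ

lemma expect_sq_le_of_sq_eq_mul {ι : Type*} [Fintype ι] {r f g : ι → ℝ}
    (hf : ∀ i, 0 ≤ f i) (hg : ∀ i, 0 ≤ g i) (h : ∀ i, r i ^ 2 = f i * g i) :
    (𝔼 i, r i) ^ 2 ≤ (𝔼 i, f i) * 𝔼 i, g i := by
  have := sum_sq_le_sum_mul_sum_of_sq_le_mul univ (fun i _ => hf i) (fun i _ => hg i)
    (fun i _ => (h i).le)
  simp only [expect_eq_sum_div_card, div_pow, div_mul_div_comm, ← sq]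
  gcongr

/-- A weight with small Fourier coefficients is nearly orthogonal to products of functions whose
Fourier coefficients have a small `ℓ¹` norm. -/
lemma norm_expect_mul_synth_mul_conj_synth_le {k : (Fin d → F) → ℝ} {κ : ℝ}
    (hk : ∀ ξ, ‖ft k ξ‖ ≤ κ) (a b : (Fin d → F) → ℂ) :
    ‖𝔼 x, (k x : ℂ) * (synth a x * conj (synth b x))‖ ≤ κ * (∑ ξ, ‖a ξ‖) * ∑ ξ, ‖b ξ‖ := by
  have h : (𝔼 x, (k x : ℂ) * (synth a x * conj (synth b x)))
      = ∑ ξ, ∑ ζ, a ξ * conj (b ζ) * ft k (ζ - ξ) := by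
    simp only [synth, map_sum, sum_mul_sum]
    simp only [mul_sum, expect_sum_comm, ft, mul_expect]
    refine sum_congr rfl fun ξ _ => sum_congr rfl fun ζ _ => expect_congr rfl fun x _ => ?_
    simp only [ch_sub_left, map_mul, Complex.conj_conj]
    ring
  rw [h, mul_assoc, sum_mul_sum, mul_sum]
  refine (norm_sum_le _ _).trans (sum_le_sum fun ξ _ => ?_)
  rw [mul_sum]
  refine (norm_sum_le _ _).trans (sum_le_sum fun ζ _ => ?_)
  rw [norm_mul, norm_mul, RCLike.norm_conj, mul_comm]
  gcongr
  exact hk _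

open Classical in
/-- The large spectrum of `g`: the frequencies at which its Fourier coefficient has size at least
`ε`. -/
noncomputable def spec (g : (Fin d → F) → ℝ) (ε : ℝ) :
    Finset (Fin d → F) := {ξ | ε ≤ ‖ft g ξ‖}

namespace IsPseudorandom

variable {σ : (Fin d → F) → ℝ} {κ : ℝ}

lemma nonneg_const (h : IsPseudorandom σ κ) : 0 ≤ κ := (norm_nonneg _).trans (h.2 0)

lemma expect_le (h : IsPseudorandom σ κ) : 𝔼 x, σ x ≤ 1 + κ := by
  have h1 := h.2 0
  have h2 : ft (σ - 1) 0 = ((𝔼 x, σ x - 1 : ℝ) : ℂ) := by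
    simp [ft, expect_sub_distrib]
  rw [h2, Complex.norm_real, Real.norm_eq_abs] at h1
  linarith [le_abs_self (𝔼 x, σ x - 1)]

lemma expect_mul_le (h : IsPseudorandom σ κ) (hκ : κ ≤ 1) {g : (Fin d → F) → ℝ} {M : ℝ}
    (hg : ∀ x, g x ≤ M) (hM : 0 ≤ M) : 𝔼 x, g x * σ x ≤ 2 * M := by
  calc 𝔼 x, g x * σ x ≤ 𝔼 x, M * σ x :=
        expect_le_expect fun x _ => mul_le_mul_of_nonneg_right (hg x) (h.1 x)
    _ = M * 𝔼 x, σ x := (mul_expect _ _ _).symm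
    _ ≤ M * 2 := by gcongr; linarith [h.expect_le]
    _ = 2 * M := mul_comm _ _

lemma norm_ft_mul_le (h : IsPseudorandom σ κ) (hκ : κ ≤ 1) {g : (Fin d → F) → ℝ} {M : ℝ}
    (hg : ∀ x, |g x| ≤ M) (hM : 0 ≤ M) (ξ : Fin d → F) : ‖ft (g * σ) ξ‖ ≤ 2 * M := by
  refine (norm_ft_le _ _).trans ((le_of_eq ?_).trans (h.expect_mul_le hκ hg hM))
  refine expect_congr rfl fun x _ => ?_
  rw [Pi.mul_apply, abs_mul, abs_of_nonneg (h.1 x)]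

/-- On functions with few Fourier coefficients, the `L²` norm weighted by `σ` is at most the
unweighted one up to a small error. -/
lemma expect_normSq_synth_le (h : IsPseudorandom σ κ) (a : (Fin d → F) → ℂ) :
    𝔼 x, ‖synth a x‖ ^ 2 * σ x ≤ ∑ ξ, ‖a ξ‖ ^ 2 + κ * (∑ ξ, ‖a ξ‖) ^ 2 := by
  have h1 := norm_expect_mul_synth_mul_conj_synth_le h.2 a a
  have h2 : (𝔼 x, (((σ - 1) x : ℝ) : ℂ) * (synth a x * conj (synth a x)))
      = ((𝔼 x, (σ x - 1) * ‖synth a x‖ ^ 2 : ℝ) : ℂ) := by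
    rw [Complex.ofReal_expect]
    refine expect_congr rfl fun x _ => ?_
    rw [RCLike.mul_conj]
    simp
  rw [h2, Complex.norm_real, Real.norm_eq_abs, mul_assoc, ← sq] at h1
  have h3 := (le_abs_self _).trans h1
  rw [← expect_normSq_synth]
  have h4 : 𝔼 x, ‖synth a x‖ ^ 2 * σ x
      = 𝔼 x, ‖synth a x‖ ^ 2 + 𝔼 x, (σ x - 1) * ‖synth a x‖ ^ 2 := by
    rw [← expect_add_distrib]
    exact expect_congr rfl fun x _ => by ring
  linarith

/-- Multiplication by `σ` barely changes the Fourier transform of a function with few Fourier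
coefficients. -/
lemma norm_ft_mul_sub_le (h : IsPseudorandom σ κ) {g : (Fin d → F) → ℝ} {a : (Fin d → F) → ℂ}
    (hg : ∀ x, (g x : ℂ) = synth a x) (ξ : Fin d → F) :
    ‖ft (g * σ) ξ - a ξ‖ ≤ κ * ∑ ξ, ‖a ξ‖ := by
  classical
  have h1 := norm_expect_mul_synth_mul_conj_synth_le h.2 a (Pi.single ξ 1)
  have h2 : ∑ ζ, ‖(Pi.single ξ 1 : (Fin d → F) → ℂ) ζ‖ = 1 := by
    simp [Pi.single_apply, apply_ite norm]
  have h3 : ft (g * σ) ξ - a ξ = ft (g * σ - g) ξ := by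
    rw [ft_sub, Pi.sub_apply, ft_eq_of_synth hg]
  rw [h2, mul_one] at h1
  rw [h3]
  refine le_trans (le_of_eq ?_) h1
  simp only [ft, ← hg, synth_single]
  congr 1
  refine expect_congr rfl fun x _ => ?_
  simp
  ring

/-- The dual restriction estimate: the Fourier transform of `f σ`, localized by a weight `w` with
values in `[0, 1]`, is square-summable with a bound which does not see `sup σ`. -/
lemma sum_mul_normSq_ft_le (h : IsPseudorandom σ κ) {f : (Fin d → F) → ℝ} {M : ℝ}
    (hf : 𝔼 x, f x ^ 2 * σ x ≤ M) {w : (Fin d → F) → ℝ} (hw0 : ∀ ξ, 0 ≤ w ξ) (hw1 : ∀ ξ, w ξ ≤ 1) :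
    ∑ ξ, w ξ * ‖ft (f * σ) ξ‖ ^ 2 ≤ M * (1 + κ * ∑ ξ, w ξ) := by
  set X := ∑ ξ, w ξ * ‖ft (f * σ) ξ‖ ^ 2 with hX
  have hX0 : 0 ≤ X := sum_nonneg fun ξ _ => mul_nonneg (hw0 ξ) (sq_nonneg _)
  have hM0 : 0 ≤ M := le_trans (expect_nonneg fun x _ => mul_nonneg (sq_nonneg _) (h.1 x)) hf
  let a : (Fin d → F) → ℂ := fun ξ => w ξ * ft (f * σ) ξ
  have ha : ∀ ξ, ‖a ξ‖ = w ξ * ‖ft (f * σ) ξ‖ := fun ξ => by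
    simp [a, abs_of_nonneg (hw0 ξ)]
  -- duality turns `X` into a pairing of `f` with the synthesis of `a`
  have h1 : ((X : ℝ) : ℂ) = 𝔼 x, (((f * σ) x : ℝ) : ℂ) * conj (synth a x) := by
    rw [expect_mul_conj_synth, hX, Complex.ofReal_sum]
    refine sum_congr rfl fun ξ _ => ?_
    simp only [a, map_mul, Complex.conj_ofReal]
    rw [mul_left_comm, RCLike.mul_conj]
    push_cast
    rfl
  have h2 : X ≤ 𝔼 x, |f x| * ‖synth a x‖ * σ x := by
    calc X = ‖(X : ℂ)‖ := by rw [Complex.norm_real, Real.norm_of_nonneg hX0]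
      _ ≤ _ := by rw [h1]; exact norm_expect_le _ _
      _ = _ := expect_congr rfl fun x _ => by
        simp [abs_of_nonneg (h.1 x)]; ring
  have h3 : (𝔼 x, |f x| * ‖synth a x‖ * σ x) ^ 2
      ≤ (𝔼 x, f x ^ 2 * σ x) * 𝔼 x, ‖synth a x‖ ^ 2 * σ x := by
    refine expect_sq_le_of_sq_eq_mul (fun x => mul_nonneg (sq_nonneg _) (h.1 x))
      (fun x => mul_nonneg (sq_nonneg _) (h.1 x)) fun x => ?_
    rw [← sq_abs (f x)]
    ring
  have h4 : ∑ ξ, ‖a ξ‖ ^ 2 ≤ X := sum_le_sum fun ξ _ => by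
    rw [ha, mul_pow]
    gcongr
    rw [sq]
    exact mul_le_of_le_one_left (hw0 ξ) (hw1 ξ)
  have h5 : (∑ ξ, ‖a ξ‖) ^ 2 ≤ (∑ ξ, w ξ) * X :=
    sum_sq_le_sum_mul_sum_of_sq_le_mul _ (fun ξ _ => hw0 ξ)
      (fun ξ _ => mul_nonneg (hw0 ξ) (sq_nonneg _)) fun ξ _ => by rw [ha]; exact le_of_eq (by ring)
  have h6 : X ^ 2 ≤ M * ((1 + κ * ∑ ξ, w ξ) * X) := by
    calc X ^ 2 ≤ (𝔼 x, |f x| * ‖synth a x‖ * σ x) ^ 2 := by gcongr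
      _ ≤ _ := h3
      _ ≤ M * (X + κ * ((∑ ξ, w ξ) * X)) := by
        have h7 := h.expect_normSq_synth_le a
        have h8 := mul_le_mul_of_nonneg_left h5 h.nonneg_const
        refine mul_le_mul hf (by linarith) ?_ hM0
        exact expect_nonneg fun x _ => mul_nonneg (sq_nonneg _) (h.1 x)
      _ = _ := by ring
  rcases hX0.eq_or_lt with h0 | h0
  · rw [← h0]
    exact mul_nonneg hM0 (add_nonneg zero_le_one
      (mul_nonneg h.nonneg_const (sum_nonneg fun ξ _ => hw0 ξ)))
  · refine le_of_mul_le_mul_right ?_ h0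
    calc X * X = X ^ 2 := (sq X).symm
      _ ≤ _ := h6
      _ = _ := by ring

lemma sum_spec_le (h : IsPseudorandom σ κ) {f : (Fin d → F) → ℝ} {M : ℝ}
    (hf : 𝔼 x, f x ^ 2 * σ x ≤ M) (A : Finset (Fin d → F)) :
    ∑ ξ ∈ A, ‖ft (f * σ) ξ‖ ^ 2 ≤ M * (1 + κ * A.card) := by
  classical
  have := h.sum_mul_normSq_ft_le hf (w := fun ξ => if ξ ∈ A then 1 else 0)
    (fun ξ => by positivity) (fun ξ => by split_ifs <;> norm_num)
  simpa using this

/-- If `τ` is at least the threshold `√(2 M κ)`, the `τ`-large spectrum of `f σ` carries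
mass at most `2 M`. -/
lemma sum_spec_le_two_mul (h : IsPseudorandom σ κ) {f : (Fin d → F) → ℝ} {M τ : ℝ}
    (hf : 𝔼 x, f x ^ 2 * σ x ≤ M) (hτ0 : 0 ≤ τ) (hτ : 2 * M * κ ≤ τ ^ 2) :
    ∑ ξ ∈ spec (f * σ) τ, ‖ft (f * σ) ξ‖ ^ 2 ≤ 2 * M := by
  have h1 := h.sum_spec_le hf (spec (f * σ) τ)
  have h2 : ((spec (f * σ) τ).card : ℝ) * τ ^ 2 ≤ ∑ ξ ∈ spec (f * σ) τ, ‖ft (f * σ) ξ‖ ^ 2 := by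
    rw [← nsmul_eq_mul]
    refine card_nsmul_le_sum _ _ _ fun ξ hξ => ?_
    simp only [spec, mem_filter, mem_univ, true_and] at hξ
    gcongr
  have h3 := mul_le_mul_of_nonneg_left hτ (Nat.cast_nonneg (α := ℝ) (spec (f * σ) τ).card)
  nlinarith

/-- The large spectrum has a number of elements bounded independently of `q`. -/
lemma card_spec_mul_sq_le (h : IsPseudorandom σ κ) {f : (Fin d → F) → ℝ} {M τ : ℝ}
    (hf : 𝔼 x, f x ^ 2 * σ x ≤ M) (hτ0 : 0 ≤ τ) (hτ : 2 * M * κ ≤ τ ^ 2) :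
    ((spec (f * σ) τ).card : ℝ) * τ ^ 2 ≤ 2 * M := by
  refine le_trans ?_ (h.sum_spec_le_two_mul hf hτ0 hτ)
  rw [← nsmul_eq_mul]
  refine card_nsmul_le_sum _ _ _ fun ξ hξ => ?_
  simp only [spec, mem_filter, mem_univ, true_and] at hξ
  gcongr

/-- The `ℓ⁴` norm of the Fourier transform of `f σ` is controlled by its supremum. Frequencies
below the threshold `√(2 M κ)` are handled by Parseval, which loses `sup σ ≤ Q`; this is affordable
as soon as `κ Q` is small. -/
lemma sum_ft_pow_four_le (h : IsPseudorandom σ κ) {f : (Fin d → F) → ℝ} {M θ Q : ℝ}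
    (hf : 𝔼 x, f x ^ 2 * σ x ≤ M) (hQ : ∀ x, σ x ≤ Q) (hθ : ∀ ξ, ‖ft (f * σ) ξ‖ ≤ θ) :
    ∑ ξ, ‖ft (f * σ) ξ‖ ^ 4 ≤ 2 * M * θ ^ 2 + 2 * M ^ 2 * (κ * Q) := by
  classical
  have hM0 : 0 ≤ M := le_trans (expect_nonneg fun x _ => mul_nonneg (sq_nonneg _) (h.1 x)) hf
  have hκ := h.nonneg_const
  have hMκ : 0 ≤ 2 * M * κ := by positivity
  -- `τ` is the smallest threshold at which the large spectrum is controlled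
  set τ := √(2 * M * κ) with hτ
  have hτ2 : τ ^ 2 = 2 * M * κ := Real.sq_sqrt hMκ
  have h1 := h.sum_spec_le_two_mul hf (Real.sqrt_nonneg _) hτ2.ge
  have h2 : ∑ ξ, ‖ft (f * σ) ξ‖ ^ 2 ≤ Q * M := by
    rw [sum_normSq_ft]
    calc 𝔼 x, (f * σ) x ^ 2 ≤ 𝔼 x, Q * (f x ^ 2 * σ x) := expect_le_expect fun x _ => by
          have := mul_le_mul_of_nonneg_left (hQ x) (mul_nonneg (sq_nonneg (f x)) (h.1 x))
          simp only [Pi.mul_apply]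
          nlinarith
      _ = Q * 𝔼 x, f x ^ 2 * σ x := (mul_expect _ _ _).symm
      _ ≤ _ := mul_le_mul_of_nonneg_left hf ((h.1 0).trans (hQ 0))
  have h3 : ∀ ξ, ‖ft (f * σ) ξ‖ ^ 4 ≤
      (if ξ ∈ spec (f * σ) τ then ‖ft (f * σ) ξ‖ ^ 2 else 0) * θ ^ 2
        + 2 * M * κ * ‖ft (f * σ) ξ‖ ^ 2 := by
    intro ξ
    have h4 : ‖ft (f * σ) ξ‖ ^ 4 = ‖ft (f * σ) ξ‖ ^ 2 * ‖ft (f * σ) ξ‖ ^ 2 := by ring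
    split_ifs with hξ
    · rw [h4]
      have := mul_le_mul_of_nonneg_left (pow_le_pow_left₀ (norm_nonneg _) (hθ ξ) 2)
        (sq_nonneg ‖ft (f * σ) ξ‖)
      have := mul_nonneg hMκ (sq_nonneg ‖ft (f * σ) ξ‖)
      linarith
    · simp only [spec, mem_filter, mem_univ, true_and, not_le] at hξ
      rw [h4, zero_mul, zero_add, ← hτ2]
      gcongr
  refine (sum_le_sum fun ξ _ => h3 ξ).trans ?_
  rw [sum_add_distrib, ← sum_mul, ← mul_sum, sum_ite_mem, univ_inter]
  have h5 := mul_le_mul_of_nonneg_right h1 (sq_nonneg θ)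
  have h6 := mul_le_mul_of_nonneg_left h2 hMκ
  calc _ ≤ 2 * M * θ ^ 2 + 2 * M * κ * (Q * M) := add_le_add h5 h6
    _ = _ := by ring

end IsPseudorandom

/-! ### Kloosterman sums and the Fourier transform of the sphere -/

open Classical in
/-- The Kloosterman sum `∑ χ(a t + b / t)` over `t ≠ 0`. -/
noncomputable def kloosterman (a b : F) : ℂ := ∑ t : Fˣ, canonicalChar F (a * t + b * (t : F)⁻¹)

lemma kloosterman_mul_inv (a b : F) (s : Fˣ) :
    kloosterman (a * s) (b * (s : F)⁻¹) = kloosterman a b := by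
  classical
  refine Fintype.sum_equiv (Equiv.mulLeft s) _ _ fun t => ?_
  simp only [Equiv.coe_mulLeft, Units.val_mul, mul_inv]
  ring_nf

/-- Two units are determined up to order by their sum and the sum of their inverses, unless the
sum vanishes. -/
lemma eq_or_eq_or_add_eq_zero {K : Type*} [Field K] {t₁ t₂ t₃ t₄ : Kˣ}
    (h : (t₁ + t₂ : K) = t₃ + t₄)
    (h' : (t₁ : K)⁻¹ + (t₂ : K)⁻¹ = (t₃ : K)⁻¹ + (t₄ : K)⁻¹) :
    (t₁ = t₃ ∧ t₂ = t₄) ∨ (t₁ = t₄ ∧ t₂ = t₃) ∨ (t₂ = -t₁ ∧ t₄ = -t₃) := by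
  have n1 := t₁.ne_zero
  have n2 := t₂.ne_zero
  have n3 := t₃.ne_zero
  have n4 := t₄.ne_zero
  simp only [Units.ext_iff, Units.val_neg]
  field_simp at h'
  have key : ((t₁ : K) + t₂) * ((t₁ - t₃) * (t₁ - t₄)) = 0 := by
    have : (t₁ : K) * t₂ * (t₁ + t₂) = t₃ * t₄ * (t₁ + t₂) := by
      linear_combination (t₁ * t₂ : K) * h - h'
    linear_combination (((t₁ : K) + t₂) * t₁) * h - this
  rcases mul_eq_zero.mp key with h0 | h0
  · right; right
    exact ⟨by linear_combination h0, by linear_combination h0 - h⟩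
  · rcases mul_eq_zero.mp h0 with h1 | h1
    · left
      exact ⟨by linear_combination h1, by linear_combination h - h1⟩
    · right; left
      exact ⟨by linear_combination h1, by linear_combination h - h1⟩

open Classical in
/-- The fourth moment counts the solutions of `t₁ + t₂ = t₃ + t₄` and
`t₁⁻¹ + t₂⁻¹ = t₃⁻¹ + t₄⁻¹`, of which there are at most `3 (q - 1) ^ 2`. -/
lemma sum_norm_kloosterman_pow_four_le :
    ∑ v : Fin 2 → F, ‖kloosterman (v 0) (v 1)‖ ^ 4
      ≤ 3 * (Fintype.card F : ℝ) ^ 2 * (Fintype.card Fˣ : ℝ) ^ 2 := by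
  let P : Fˣ × Fˣ → Fin 2 → F := fun s => ![s.1 + s.2, (s.1 : F)⁻¹ + (s.2 : F)⁻¹]
  have h1 : ∀ v : Fin 2 → F, kloosterman (v 0) (v 1) ^ 2 = ∑ s : Fˣ × Fˣ, ch (P s) v := by
    intro v
    rw [sq, kloosterman, sum_mul_sum, ← sum_product', univ_product_univ]
    refine sum_congr rfl fun s _ => ?_
    rw [← AddChar.map_add_eq_mul]
    simp only [ch, P, dotProduct, Fin.sum_univ_two, Matrix.cons_val_zero, Matrix.cons_val_one]
    ring_nf
  have h2 : ∀ v : Fin 2 → F, ((‖kloosterman (v 0) (v 1)‖ ^ 4 : ℝ) : ℂ)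
      = ∑ s : Fˣ × Fˣ, ∑ s' : Fˣ × Fˣ, ch (P s - P s') v := by
    intro v
    have : ((‖kloosterman (v 0) (v 1)‖ ^ 4 : ℝ) : ℂ)
        = kloosterman (v 0) (v 1) ^ 2 * conj (kloosterman (v 0) (v 1) ^ 2) := by
      rw [Complex.mul_conj', norm_pow]
      push_cast
      ring
    rw [this, h1, map_sum, sum_mul_sum]
    simp only [ch_sub_left]
  have h3 : ((∑ v : Fin 2 → F, ‖kloosterman (v 0) (v 1)‖ ^ 4 : ℝ) : ℂ)
      = (((Fintype.card F : ℝ) ^ 2 * (#{z : (Fˣ × Fˣ) × Fˣ × Fˣ | P z.1 = P z.2} : ℝ) : ℝ) : ℂ) := by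
    rw [Complex.ofReal_sum]
    simp only [h2]
    rw [sum_comm]
    have : ∀ s, ∑ v, ∑ s', ch (P s - P s') v
        = ∑ s', if P s = P s' then (Fintype.card F : ℂ) ^ 2 else 0 := by
      intro s
      rw [sum_comm]
      refine sum_congr rfl fun s' _ => ?_
      rw [sum_ch]
      simp [sub_eq_zero]
    simp only [this]
    rw [← sum_product', univ_product_univ, ← sum_filter, sum_const]
    push_cast
    rw [nsmul_eq_mul, mul_comm]
  rw [Complex.ofReal_injective h3]
  have h4 : #{z : (Fˣ × Fˣ) × Fˣ × Fˣ | P z.1 = P z.2} ≤ 3 * Fintype.card Fˣ ^ 2 := by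
    have hsub : ({z : (Fˣ × Fˣ) × Fˣ × Fˣ | P z.1 = P z.2} : Finset _) ⊆
        (univ.image fun s : Fˣ × Fˣ => (s, s)) ∪
          ((univ.image fun s : Fˣ × Fˣ => (s, s.swap)) ∪
            (univ.image fun s : Fˣ × Fˣ => ((s.1, -s.1), (s.2, -s.2)))) := by
      rintro ⟨⟨t₁, t₂⟩, ⟨t₃, t₄⟩⟩ hz
      simp only [mem_filter, mem_univ, true_and, P] at hz
      have e0 := congrFun hz 0
      have e1 := congrFun hz 1
      simp only [Matrix.cons_val_zero, Matrix.cons_val_one] at e0 e1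
      simp only [mem_union, mem_image, mem_univ, true_and, Prod.mk.injEq, Prod.exists,
        Prod.swap_prod_mk]
      rcases eq_or_eq_or_add_eq_zero e0 e1 with ⟨rfl, rfl⟩ | ⟨rfl, rfl⟩ | ⟨rfl, rfl⟩
      · exact Or.inl ⟨_, _, ⟨rfl, rfl⟩, rfl, rfl⟩
      · exact Or.inr (Or.inl ⟨_, _, ⟨rfl, rfl⟩, rfl, rfl⟩)
      · exact Or.inr (Or.inr ⟨_, _, ⟨rfl, rfl⟩, rfl, rfl⟩)
    have hc : Fintype.card (Fˣ × Fˣ) = Fintype.card Fˣ ^ 2 := by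
      rw [Fintype.card_prod, sq]
    have c1 := card_le_card hsub
    have c2 := card_union_le (univ.image fun s : Fˣ × Fˣ => (s, s))
      ((univ.image fun s : Fˣ × Fˣ => (s, s.swap)) ∪
            (univ.image fun s : Fˣ × Fˣ => ((s.1, -s.1), (s.2, -s.2))))
    have c3 := card_union_le (univ.image fun s : Fˣ × Fˣ => (s, s.swap))
            (univ.image fun s : Fˣ × Fˣ => ((s.1, -s.1), (s.2, -s.2)))
    have c4 := card_image_le (s := univ) (f := fun s : Fˣ × Fˣ => (s, s))
    have c5 := card_image_le (s := univ) (f := fun s : Fˣ × Fˣ => (s, s.swap))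
    have c6 := card_image_le (s := univ) (f := fun s : Fˣ × Fˣ => ((s.1, -s.1), (s.2, -s.2)))
    rw [card_univ, hc] at c4 c5 c6
    omega
  have h5 : (#{z : (Fˣ × Fˣ) × Fˣ × Fˣ | P z.1 = P z.2} : ℝ) ≤ 3 * (Fintype.card Fˣ : ℝ) ^ 2 := by
    exact_mod_cast h4
  calc _ ≤ (Fintype.card F : ℝ) ^ 2 * (3 * (Fintype.card Fˣ : ℝ) ^ 2) := by gcongr
    _ = _ := by ring

/-- Kloosterman's bound: a sum `kloosterman a b` with `a ≠ 0` is repeated `q - 1` times in the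
fourth moment. -/
lemma norm_kloosterman_pow_four_le {a : F} (ha : a ≠ 0) (b : F) :
    ‖kloosterman a b‖ ^ 4 ≤ 3 * (Fintype.card F : ℝ) ^ 3 := by
  classical
  let v : Fˣ → Fin 2 → F := fun s => ![a * s, b * (s : F)⁻¹]
  have hv : Function.Injective v := by
    intro s s' h
    have := congrFun h 0
    simp only [v, Matrix.cons_val_zero] at this
    exact Units.ext (mul_left_cancel₀ ha this)
  have h1 : (Fintype.card Fˣ : ℝ) * ‖kloosterman a b‖ ^ 4
      ≤ ∑ v : Fin 2 → F, ‖kloosterman (v 0) (v 1)‖ ^ 4 := by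
    calc (Fintype.card Fˣ : ℝ) * ‖kloosterman a b‖ ^ 4
        = ∑ s : Fˣ, ‖kloosterman (v s 0) (v s 1)‖ ^ 4 := by
          simp [v, kloosterman_mul_inv]
      _ = ∑ w ∈ univ.image v, ‖kloosterman (w 0) (w 1)‖ ^ 4 := by
          rw [sum_image fun x _ y _ h => hv h]
      _ ≤ _ := sum_le_sum_of_subset_of_nonneg (subset_univ _) fun _ _ _ => by positivity
  have h2 := h1.trans sum_norm_kloosterman_pow_four_le
  have hpos : (0 : ℝ) < Fintype.card Fˣ := by exact_mod_cast Fintype.card_pos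
  have hle : (Fintype.card Fˣ : ℝ) ≤ Fintype.card F := by
    exact_mod_cast Fintype.card_le_of_injective _ Units.val_injective
  have h3 : ‖kloosterman a b‖ ^ 4 ≤ 3 * (Fintype.card F : ℝ) ^ 2 * Fintype.card Fˣ := by
    refine le_of_mul_le_mul_left ?_ hpos
    calc _ ≤ _ := h2
      _ = _ := by ring
  calc _ ≤ _ := h3
    _ ≤ 3 * (Fintype.card F : ℝ) ^ 2 * Fintype.card F := by gcongr
    _ = _ := by ring

/-- The normalized Gauss sum of the quadratic form `t x · x` on `F ^ d`, at the frequency `ξ`. -/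
noncomputable def quadGauss (t : F) (ξ : Fin d → F) : ℂ :=
  𝔼 x : Fin d → F, canonicalChar F (t * (x ⬝ᵥ x)) * conj (ch ξ x)

lemma quadGauss_eq (h2 : (2 : F) ≠ 0) {t : F} (ht : t ≠ 0) (ξ : Fin d → F) :
    quadGauss t ξ = canonicalChar F (-(ξ ⬝ᵥ ξ) / 4 * t⁻¹) * quadGauss t (0 : Fin d → F) := by
  have h4 : (4 : F) ≠ 0 := by
    have : (4 : F) = 2 * 2 := by norm_num
    rw [this]; exact mul_ne_zero h2 h2
  rw [quadGauss, quadGauss, mul_expect]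
  -- complete the square
  refine Fintype.expect_equiv (Equiv.subRight ((2 * t)⁻¹ • ξ)) _ _ fun x => ?_
  simp only [ch_zero_left, map_one, mul_one]
  simp only [Equiv.subRight_apply, ch, ← canonicalChar_neg, ← AddChar.map_add_eq_mul]
  congr 1
  simp only [sub_dotProduct, dotProduct_sub, smul_dotProduct, dotProduct_smul, smul_eq_mul,
    dotProduct_comm x ξ]
  field_simp
  ring

lemma norm_quadGauss_sq (h2 : (2 : F) ≠ 0) {t : F} (ht : t ≠ 0) :
    ‖quadGauss t (0 : Fin d → F)‖ ^ 2 = ((Fintype.card F : ℝ) ^ d)⁻¹ := by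
  classical
  have h : ((‖quadGauss t (0 : Fin d → F)‖ ^ 2 : ℝ) : ℂ)
      = 𝔼 h : Fin d → F, canonicalChar F (t * (h ⬝ᵥ h)) * 𝔼 y, ch ((2 * t) • h) y := by
    have h1 : ((‖quadGauss t (0 : Fin d → F)‖ ^ 2 : ℝ) : ℂ)
        = conj (quadGauss t (0 : Fin d → F)) * quadGauss t (0 : Fin d → F) := by
      rw [RCLike.conj_mul]; push_cast; rfl
    rw [h1, quadGauss, conj_expect, expect_mul]
    simp only [mul_expect]
    rw [expect_comm (univ : Finset (Fin d → F)) univ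
      (fun h y => canonicalChar F (t * (h ⬝ᵥ h)) * ch ((2 * t) • h) y)]
    refine expect_congr rfl fun y _ => ?_
    refine Fintype.expect_equiv (Equiv.subRight y) _ _ fun x => ?_
    simp only [ch_zero_left, map_one, mul_one]
    simp only [Equiv.subRight_apply, ch, ← canonicalChar_neg, ← AddChar.map_add_eq_mul]
    congr 1
    simp only [sub_dotProduct, dotProduct_sub, smul_dotProduct, smul_eq_mul,
      dotProduct_comm y x]
    ring
  simp only [expect_ch, smul_eq_zero, mul_eq_zero, h2, ht, false_or] at h
  apply Complex.ofReal_injective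
  rw [h, expect_eq_sum_div_card]
  simp

lemma exists_sq_add_sq (hF : ringChar F ≠ 2) (t : F) : ∃ a b : F, a ^ 2 + b ^ 2 = t := by
  open Polynomial in
  obtain ⟨a, b, h⟩ := FiniteField.exists_root_sum_quadratic (R := F) (f := X ^ 2)
    (g := X ^ 2 - C t) (degree_X_pow 2) (degree_X_pow_sub_C (by norm_num) t)
    (FiniteField.odd_card_of_char_ne_two hF)
  refine ⟨a, b, ?_⟩
  simp only [Polynomial.eval_pow, Polynomial.eval_X, Polynomial.eval_sub, Polynomial.eval_C] at h
  linear_combination h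

/-- In dimension four the quadratic form `x · x` has similitudes of every nonzero multiplier, so
that its Gauss sums all agree. -/
lemma quadGauss_four_eq (hF : ringChar F ≠ 2) {t : F} (ht : t ≠ 0) :
    quadGauss t (0 : Fin 4 → F) = quadGauss 1 (0 : Fin 4 → F) := by
  obtain ⟨a, b, rfl⟩ := exists_sq_add_sq hF t
  let T : (Fin 4 → F) → (Fin 4 → F) := fun x =>
    ![a * x 0 - b * x 1, b * x 0 + a * x 1, a * x 2 - b * x 3, b * x 2 + a * x 3]
  have hT : Function.Injective T := by
    intro x y h
    have e0 := congrFun h 0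
    have e1 := congrFun h 1
    have e2 := congrFun h 2
    have e3 := congrFun h 3
    simp only [T, Matrix.cons_val] at e0 e1 e2 e3
    ext i
    refine mul_left_cancel₀ ht ?_
    fin_cases i
    · change (a ^ 2 + b ^ 2) * x 0 = (a ^ 2 + b ^ 2) * y 0
      linear_combination a * e0 + b * e1
    · change (a ^ 2 + b ^ 2) * x 1 = (a ^ 2 + b ^ 2) * y 1
      linear_combination a * e1 - b * e0
    · change (a ^ 2 + b ^ 2) * x 2 = (a ^ 2 + b ^ 2) * y 2
      linear_combination a * e2 + b * e3
    · change (a ^ 2 + b ^ 2) * x 3 = (a ^ 2 + b ^ 2) * y 3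
      linear_combination a * e3 - b * e2
  refine Fintype.expect_bijective T (Finite.injective_iff_bijective.mp hT) _ _ fun x => ?_
  simp only [ch_zero_left, map_one, mul_one, one_mul, dotProduct, Fin.sum_univ_four, T,
    Matrix.cons_val]
  congr 1
  ring

open Classical in
lemma sphereMeasure_sub_one (lam : F) (x : Fin d → F) :
    ((sphereMeasure lam x - 1 : ℝ) : ℂ) = ∑ t : Fˣ, canonicalChar F (t * (x ⬝ᵥ x - lam)) := by
  have h1 := AddChar.sum_mulShift (x ⬝ᵥ x - lam) (canonicalChar_isPrimitive (F := F))
  have h2 : ∑ t : F, canonicalChar F (t * (x ⬝ᵥ x - lam))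
      = 1 + ∑ t : Fˣ, canonicalChar F (t * (x ⬝ᵥ x - lam)) := by
    rw [Fintype.sum_eq_add_sum_subtype_ne _ (0 : F)]
    congr 1
    · simp
    · exact (Fintype.sum_equiv unitsEquivNeZero _ _ fun t => rfl).symm
  rw [h2] at h1
  simp only [sub_eq_zero] at h1
  rw [eq_sub_of_add_eq' h1, sphereMeasure]
  split_ifs <;> simp

open Classical in
/-- Expanding the indicator of the sphere in characters leaves a twisted sum of Gauss sums. -/
lemma ft_sphereMeasure_sub_one (h2 : (2 : F) ≠ 0) (lam : F) (ξ : Fin d → F) :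
    ft (sphereMeasure lam - 1) ξ = ∑ t : Fˣ,
      canonicalChar F (-lam * t + -(ξ ⬝ᵥ ξ) / 4 * (t : F)⁻¹) * quadGauss (t : F) (0 : Fin d → F) := by
  classical
  have h : ∀ t : Fˣ, canonicalChar F (-lam * t + -(ξ ⬝ᵥ ξ) / 4 * (t : F)⁻¹)
      * quadGauss (t : F) (0 : Fin d → F)
        = 𝔼 x, canonicalChar F (t * (x ⬝ᵥ x - lam)) * conj (ch ξ x) := by
    intro t
    rw [AddChar.map_add_eq_mul, mul_assoc, ← quadGauss_eq h2 t.ne_zero, quadGauss, mul_expect]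
    refine expect_congr rfl fun x _ => ?_
    rw [← mul_assoc, ← AddChar.map_add_eq_mul]
    ring_nf
  simp only [h, ← expect_sum_comm, ft, Pi.sub_apply, Pi.one_apply, sphereMeasure_sub_one, sum_mul]

/-- The nontrivial Fourier coefficients of the sphere measure are of size `O(q ^ (-5/4))`, in every
dimension at least four. -/
lemma norm_ft_sphereMeasure_sub_one_pow_four_le (hF : ringChar F ≠ 2) (hd : 4 ≤ d) {lam : F}
    (hlam : lam ≠ 0) (ξ : Fin d → F) :
    ‖ft (sphereMeasure lam - 1) ξ‖ ^ 4 * (Fintype.card F : ℝ) ^ 5 ≤ 3 := by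
  classical
  have h2 : (2 : F) ≠ 0 := Ring.two_ne_zero hF
  have hq : (1 : ℝ) ≤ Fintype.card F := by exact_mod_cast Fintype.card_pos
  have hq0 : (0 : ℝ) < Fintype.card F := by linarith
  rw [ft_sphereMeasure_sub_one h2]
  rcases hd.eq_or_lt with rfl | hd
  · have h3 : ∀ t : Fˣ, quadGauss (t : F) (0 : Fin 4 → F) = quadGauss 1 (0 : Fin 4 → F) :=
      fun t => quadGauss_four_eq hF t.ne_zero
    simp only [h3, ← sum_mul]
    change ‖kloosterman (-lam) (-(ξ ⬝ᵥ ξ) / 4) * _‖ ^ 4 * _ ≤ _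
    have h4 := norm_kloosterman_pow_four_le (neg_ne_zero.mpr hlam) (-(ξ ⬝ᵥ ξ) / 4)
    have h5 := norm_quadGauss_sq (d := 4) h2 one_ne_zero
    have h6 : ‖quadGauss 1 (0 : Fin 4 → F)‖ ^ 4 = (((Fintype.card F : ℝ) ^ 4)⁻¹) ^ 2 := by
      rw [← h5]; ring
    rw [norm_mul, mul_pow, h6]
    calc _ ≤ 3 * (Fintype.card F : ℝ) ^ 3 * (((Fintype.card F : ℝ) ^ 4)⁻¹) ^ 2
          * (Fintype.card F : ℝ) ^ 5 := by gcongr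
      _ = 3 := by field_simp
  · have h3 : ∀ t : Fˣ, ‖quadGauss (t : F) (0 : Fin d → F)‖ = √((Fintype.card F : ℝ) ^ d)⁻¹ := by
      intro t
      rw [← norm_quadGauss_sq h2 t.ne_zero, Real.sqrt_sq (norm_nonneg _)]
    have h4 := norm_sum_le univ fun t : Fˣ =>
      canonicalChar F (-lam * t + -(ξ ⬝ᵥ ξ) / 4 * (t : F)⁻¹) * quadGauss (t : F) (0 : Fin d → F)
    simp only [norm_mul, norm_canonicalChar, one_mul, h3, sum_const, nsmul_eq_mul, card_univ] at h4
    have hle : (Fintype.card Fˣ : ℝ) ≤ Fintype.card F := by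
      exact_mod_cast Fintype.card_le_of_injective _ Units.val_injective
    have h5 : √((Fintype.card F : ℝ) ^ d)⁻¹ ^ 4 = (((Fintype.card F : ℝ) ^ d)⁻¹) ^ 2 := by
      have := Real.sq_sqrt (inv_nonneg.mpr (pow_nonneg hq0.le d))
      calc _ = (√((Fintype.card F : ℝ) ^ d)⁻¹ ^ 2) ^ 2 := by ring
        _ = _ := by rw [this]
    have h6 : (Fintype.card F : ℝ) ^ 5 ≤ (Fintype.card F : ℝ) ^ d := pow_le_pow_right₀ hq hd
    calc _ ≤ (Fintype.card F * √((Fintype.card F : ℝ) ^ d)⁻¹) ^ 4 * (Fintype.card F : ℝ) ^ 5 := by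
          gcongr
          exact h4.trans (by gcongr)
      _ = (Fintype.card F : ℝ) ^ 9 * (((Fintype.card F : ℝ) ^ d)⁻¹) ^ 2 := by
          rw [mul_pow, h5]; ring
      _ ≤ (Fintype.card F : ℝ) ^ 9 * (((Fintype.card F : ℝ) ^ 5)⁻¹) ^ 2 := by gcongr
      _ = (Fintype.card F : ℝ)⁻¹ := by field_simp
      _ ≤ 1 := inv_le_one_of_one_le₀ hq
      _ ≤ 3 := by norm_num

lemma sphereMeasure_nonneg (lam : F) (x : Fin d → F) : 0 ≤ sphereMeasure lam x := by
  rw [sphereMeasure]; split_ifs <;> positivity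

lemma sphereMeasure_le (lam : F) (x : Fin d → F) : sphereMeasure lam x ≤ Fintype.card F := by
  rw [sphereMeasure]; split_ifs <;> simp

/-- Once `q` is large, the sphere measure is pseudorandom with an error `δ / q`. -/
lemma isPseudorandom_sphereMeasure (hF : ringChar F ≠ 2) (hd : 4 ≤ d) {lam : F} (hlam : lam ≠ 0)
    {δ : ℝ} (hδ : 0 < δ) (hq : 3 / δ ^ 4 ≤ Fintype.card F) :
    IsPseudorandom (sphereMeasure lam : (Fin d → F) → ℝ) (δ / Fintype.card F) := by
  have hq0 : (0 : ℝ) < Fintype.card F := by exact_mod_cast Fintype.card_pos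
  refine ⟨sphereMeasure_nonneg lam, fun ξ => ?_⟩
  have h := norm_ft_sphereMeasure_sub_one_pow_four_le hF hd hlam ξ
  refine le_of_pow_le_pow_left₀ (n := 4) (by norm_num) (by positivity) ?_
  rw [div_pow, le_div_iff₀ (by positivity)]
  rw [div_le_iff₀ (by positivity)] at hq
  refine le_of_mul_le_mul_right ?_ hq0
  calc _ = _ := by ring
    _ ≤ _ := h
    _ ≤ _ := hq
    _ = _ := mul_comm _ _

/-! ### Bohr sets: covering, regular radii, and Fourier coefficients -/

lemma mem_bohr {Γ : Finset (Fin d → F)} {ρ : ℝ} {x : Fin d → F} :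
    x ∈ bohr Γ ρ ↔ ∀ ξ ∈ Γ, ‖ch ξ x - 1‖ ≤ ρ := by
  simp [bohr, ch]

lemma bohr_mono (Γ : Finset (Fin d → F)) {ρ ρ' : ℝ} (h : ρ ≤ ρ') : bohr Γ ρ ⊆ bohr Γ ρ' :=
  fun _ hx => mem_bohr.mpr fun ξ hξ => (mem_bohr.mp hx ξ hξ).trans h

lemma zero_mem_bohr (Γ : Finset (Fin d → F)) {ρ : ℝ} (h : 0 ≤ ρ) : (0 : Fin d → F) ∈ bohr Γ ρ :=
  mem_bohr.mpr fun ξ _ => by simpa using h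

lemma card_bohr_pos (Γ : Finset (Fin d → F)) {ρ : ℝ} (h : 0 ≤ ρ) : 0 < (bohr Γ ρ).card :=
  card_pos.mpr ⟨0, zero_mem_bohr Γ h⟩

lemma neg_mem_bohr {Γ : Finset (Fin d → F)} {ρ : ℝ} {x : Fin d → F} (hx : x ∈ bohr Γ ρ) :
    -x ∈ bohr Γ ρ := by
  refine mem_bohr.mpr fun ξ hξ => ?_
  have : ch ξ (-x) - 1 = conj (ch ξ x - 1) := by rw [ch_neg_right]; simp
  rw [this, RCLike.norm_conj]
  exact mem_bohr.mp hx ξ hξ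

/-- Covering a large Bohr set by translates of a small one: the values of the characters in `Γ` are
sorted into square cells of side `s / 2` in the complex plane. -/
lemma card_bohr_le_pow_mul (Γ : Finset (Fin d → F)) {R s : ℝ} (hs : 0 < s) {m : ℕ}
    (hm : 2 * R / s ≤ m) :
    (bohr Γ R).card ≤ (2 * m + 1) ^ (2 * Γ.card) * (bohr Γ s).card := by
  classical
  let cell : (Fin d → F) → Γ → ℤ × ℤ := fun x ξ =>
    (⌊2 * (ch ξ.1 x - 1).re / s⌋, ⌊2 * (ch ξ.1 x - 1).im / s⌋)
  let T : Finset (Γ → ℤ × ℤ) :=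
    Fintype.piFinset fun _ => Icc (-(m : ℤ)) m ×ˢ Icc (-(m : ℤ)) m
  have hfloor : ∀ t : ℝ, |t| ≤ R → ⌊2 * t / s⌋ ∈ Icc (-(m : ℤ)) m := by
    intro t ht
    rw [abs_le] at ht
    have h1 : 2 * t / s ≤ m := le_trans (by gcongr; exact ht.2) hm
    have h2 : -(m : ℝ) ≤ 2 * t / s := by
      have : -(2 * R / s) ≤ 2 * t / s := by
        rw [← neg_div]
        gcongr
        linarith [ht.1]
      linarith
    rw [mem_Icc, Int.le_floor]
    refine ⟨by push_cast; exact h2, ?_⟩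
    exact_mod_cast (Int.floor_le _).trans h1
  have hcell : ∀ x ∈ bohr Γ R, cell x ∈ T := by
    intro x hx
    simp only [T, Fintype.mem_piFinset, mem_product]
    intro ξ
    have := mem_bohr.mp hx ξ.1 ξ.2
    exact ⟨hfloor _ ((Complex.abs_re_le_norm _).trans this),
      hfloor _ ((Complex.abs_im_le_norm _).trans this)⟩
  have hT : T.card = (2 * m + 1) ^ (2 * Γ.card) := by
    simp only [T, Fintype.card_piFinset, card_product, Int.card_Icc, prod_const, card_univ,
      Fintype.card_coe]
    have : ((m : ℤ) + 1 - -m).toNat = 2 * m + 1 := by omega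
    rw [this, ← sq, ← pow_mul]
  have hfib : ∀ b ∈ T, #{x ∈ bohr Γ R | cell x = b} ≤ (bohr Γ s).card := by
    intro b _
    rcases ({x ∈ bohr Γ R | cell x = b} : Finset _).eq_empty_or_nonempty with h0 | ⟨y, hy⟩
    · rw [h0]; simp
    refine card_le_card_of_injOn (fun x => x - y) (fun x hx => ?_)
      (fun x _ x' _ h => sub_left_injective h)
    simp only [coe_filter, Set.mem_ofPred_eq, mem_filter] at hx hy
    refine mem_coe.mpr (mem_bohr.mpr fun ξ hξ => ?_)
    have hc := congrFun (hx.2.trans hy.2.symm) ⟨ξ, hξ⟩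
    simp only [cell, Prod.mk.injEq] at hc
    have e1 := Int.abs_sub_lt_one_of_floor_eq_floor hc.1
    have e2 := Int.abs_sub_lt_one_of_floor_eq_floor hc.2
    have key : ∀ u v : ℝ, |2 * u / s - 2 * v / s| < 1 → |u - v| ≤ s / 2 := by
      intro u v h
      rw [← sub_div, ← mul_sub, abs_div, abs_mul, abs_of_pos hs, abs_two, div_lt_one hs] at h
      linarith
    have e1' := key _ _ e1
    have e2' := key _ _ e2
    have hn : ‖ch ξ (x - y) - 1‖ = ‖(ch ξ x - 1) - (ch ξ y - 1)‖ := by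
      have h1 : ch ξ y * conj (ch ξ y) = 1 := by rw [RCLike.mul_conj]; simp
      have h2 : (ch ξ x - 1) - (ch ξ y - 1) = ch ξ y * (ch ξ (x - y) - 1) := by
        rw [ch_sub_right]
        linear_combination (-ch ξ x) * h1
      rw [h2, norm_mul, norm_ch, one_mul]
    rw [hn]
    refine (Complex.norm_le_abs_re_add_abs_im _).trans ?_
    rw [Complex.sub_re, Complex.sub_im]
    linarith
  rw [← hT, mul_comm]
  exact card_le_mul_card_image_of_maps_to hcell _ hfib

/-- The reciprocal density of a Bohr set is bounded in terms of its rank and radius. -/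
lemma card_div_card_bohr_le (Γ : Finset (Fin d → F)) {ρ : ℝ} (h0 : 0 < ρ) (h1 : ρ ≤ 1) :
    (Fintype.card F : ℝ) ^ d / (bohr Γ ρ).card ≤ (11 / ρ) ^ (2 * Γ.card) := by
  have hB : (0 : ℝ) < (bohr Γ ρ).card := by exact_mod_cast card_bohr_pos Γ h0.le
  have huniv : bohr Γ 2 = univ := by
    ext x
    simp only [mem_univ, iff_true]
    refine mem_bohr.mpr fun ξ _ => (norm_sub_le _ _).trans ?_
    simp; norm_num
  have h := card_bohr_le_pow_mul Γ (R := 2) h0 (m := ⌈2 * 2 / ρ⌉₊) (Nat.le_ceil _)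
  rw [huniv, card_univ] at h
  have hc : Fintype.card (Fin d → F) = Fintype.card F ^ d := by simp
  rw [hc] at h
  rw [div_le_iff₀ hB]
  have h' : (Fintype.card F : ℝ) ^ d
      ≤ (2 * (⌈2 * 2 / ρ⌉₊ : ℝ) + 1) ^ (2 * Γ.card) * (bohr Γ ρ).card := by exact_mod_cast h
  refine h'.trans ?_
  gcongr
  have h2 := (Nat.ceil_lt_add_one (by positivity : (0 : ℝ) ≤ 2 * 2 / ρ)).le
  have h3 : (1 : ℝ) ≤ 1 / ρ := by rw [le_div_iff₀ h0]; linarith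
  calc 2 * (⌈2 * 2 / ρ⌉₊ : ℝ) + 1 ≤ 2 * (2 * 2 / ρ + 1) + 1 := by gcongr
    _ = 8 * (1 / ρ) + 3 := by ring
    _ ≤ 11 * (1 / ρ) := by linarith
    _ = 11 / ρ := by ring

/-- The increments of a monotone function over disjoint intervals add up to at most its total
increment. -/
lemma _root_.Monotone.sum_sub_le_of_pairwiseDisjoint {ι : Type*} {G : ℝ → ℝ} (hG : Monotone G)
    {a b : ι → ℝ} {A B : ℝ} (s : Finset ι) (hAB : A ≤ B) (hab : ∀ i ∈ s, a i ≤ b i)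
    (hA : ∀ i ∈ s, A ≤ a i) (hB : ∀ i ∈ s, b i ≤ B)
    (hd : (s : Set ι).PairwiseDisjoint fun i => Set.Icc (a i) (b i)) :
    ∑ i ∈ s, (G (b i) - G (a i)) ≤ G B - G A := by
  classical
  induction s using Finset.induction_on_max_value a generalizing B with
  | empty => simpa using hG hAB
  | insert i s hi hmax ih =>
    rw [sum_insert hi]
    have hs : ∑ j ∈ s, (G (b j) - G (a j)) ≤ G (a i) - G A := by
      refine ih (hA i (mem_insert_self _ _)) (fun j hj => hab j (mem_insert_of_mem hj))
        (fun j hj => hA j (mem_insert_of_mem hj)) (fun j hj => ?_)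
        (hd.subset (by simp))
      by_contra! hlt
      have hne : j ≠ i := fun h => hi (h ▸ hj)
      have hmem : a i ∈ Set.Icc (a j) (b j) := ⟨hmax j hj, hlt.le⟩
      exact Set.disjoint_left.mp (hd (by simp [hj]) (by simp) hne) hmem
        ⟨le_rfl, hab i (mem_insert_self _ _)⟩
    have := hG (hB i (mem_insert_self _ _))
    linarith

lemma monotone_log_card_bohr (Γ : Finset (Fin d → F)) :
    Monotone fun t : ℝ => Real.log (bohr Γ t).card := by
  intro s t hst
  have h := card_le_card (bohr_mono Γ hst)
  simp only
  rcases Nat.eq_zero_or_pos (bohr Γ s).card with h0 | h0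
  · rw [h0]; simpa using Real.log_natCast_nonneg _
  · exact Real.log_le_log (by exact_mod_cast h0) (by exact_mod_cast h)

/-- Where regularity fails, the Bohr set grows too fast on some interval around the radius. -/
lemma exists_growth_of_not_isRegular {Γ : Finset (Fin d → F)} (hΓ : Γ.Nonempty) {ρ : ℝ}
    (h0 : 0 < ρ) (h : ¬ IsRegular Γ ρ) :
    ∃ ε x : ℝ, 0 < ε ∧ 100 * ε ≤ 1 ∧ |ρ - x| ≤ ε * ρ / 2 ∧
      50 * ε * Γ.card ≤ Real.log (bohr Γ (x + ε * ρ / 2)).card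
        - Real.log (bohr Γ (x - ε * ρ / 2)).card ∧
      (bohr Γ (x - ε * ρ / 2)).card < (bohr Γ (x + ε * ρ / 2)).card := by
  simp only [IsRegular, not_forall, not_and_or, not_le] at h
  obtain ⟨ε, hε, hε1, h⟩ := h
  have hn : (1 : ℝ) ≤ Γ.card := by exact_mod_cast hΓ.card_pos
  have hε2 : 100 * ε ≤ 1 := (le_mul_of_one_le_right (by positivity) hn).trans hε1
  set y := 100 * ε * (Γ.card : ℝ) with hy
  have hy0 : 0 < y := by positivity
  have hgrowth : ∀ s t : ℝ, 0 < s → s ≤ t →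
      ((bohr Γ s).card : ℝ) ≤ (1 - y / 2) * (bohr Γ t).card →
      50 * ε * Γ.card ≤ Real.log (bohr Γ t).card - Real.log (bohr Γ s).card ∧
      (bohr Γ s).card < (bohr Γ t).card := by
    intro s t hs ht hst
    have hBs : (0 : ℝ) < (bohr Γ s).card := by exact_mod_cast card_bohr_pos Γ hs.le
    have hBt : (0 : ℝ) < (bohr Γ t).card := by
      exact_mod_cast card_bohr_pos Γ (hs.le.trans ht)
    constructor
    · rw [← Real.log_div hBt.ne' hBs.ne']
      have h1 := Real.one_sub_inv_le_log_of_pos (div_pos hBt hBs)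
      rw [inv_div] at h1
      have h2 : ((bohr Γ s).card : ℝ) / (bohr Γ t).card ≤ 1 - y / 2 := by
        rwa [div_le_iff₀ hBt]
      linarith
    · have : ((bohr Γ s).card : ℝ) < (bohr Γ t).card := by nlinarith
      exact_mod_cast this
  have hερ : 0 < ε * ρ := mul_pos hε h0
  rcases h with h | h
  · refine ⟨ε, ρ + ε * ρ / 2, hε, hε2, ?_, ?_⟩
    · rw [sub_add_cancel_left, abs_neg, abs_of_pos (by positivity)]
    · have e1 : ρ + ε * ρ / 2 + ε * ρ / 2 = (1 + ε) * ρ := by ring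
      have e2 : ρ + ε * ρ / 2 - ε * ρ / 2 = ρ := by ring
      rw [e1, e2]
      refine hgrowth _ _ h0 (by linarith) ?_
      have hB : (0 : ℝ) < (bohr Γ ρ).card := by exact_mod_cast card_bohr_pos Γ h0.le
      have h3 := mul_le_mul_of_nonneg_left h.le (by linarith : 0 ≤ 1 - y / 2)
      have h4 : (1 : ℝ) ≤ (1 - y / 2) * (1 + y) := by nlinarith
      have h5 := mul_le_mul_of_nonneg_right h4 hB.le
      linarith
  · refine ⟨ε, ρ - ε * ρ / 2, hε, hε2, ?_, ?_⟩
    · rw [sub_sub_cancel, abs_of_pos (by positivity)]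
    · have e1 : ρ - ε * ρ / 2 + ε * ρ / 2 = ρ := by ring
      have e2 : ρ - ε * ρ / 2 - ε * ρ / 2 = (1 - ε) * ρ := by ring
      rw [e1, e2]
      refine hgrowth _ _ (mul_pos (by linarith) h0) (by linarith) (h.le.trans ?_)
      gcongr
      linarith

/-- Every scale contains a regular radius. Otherwise Vitali's covering lemma extracts disjoint
intervals of fast growth whose total growth exceeds the doubling bound. -/
lemma exists_isRegular {Γ : Finset (Fin d → F)} (hΓ : Γ.Nonempty) {r : ℝ} (hr : 0 < r) :
    ∃ ρ ∈ Set.Icc (r / 2) r, IsRegular Γ ρ := by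
  classical
  by_contra! hbad
  have hpos : ∀ ρ ∈ Set.Icc (r / 2) r, 0 < ρ := fun ρ hρ => by linarith [hρ.1]
  have hch : ∀ ρ : ℝ, ∃ ε x : ℝ, ρ ∈ Set.Icc (r / 2) r → (0 < ε ∧ 100 * ε ≤ 1 ∧
      |ρ - x| ≤ ε * ρ / 2 ∧
      50 * ε * Γ.card ≤ Real.log (bohr Γ (x + ε * ρ / 2)).card
        - Real.log (bohr Γ (x - ε * ρ / 2)).card ∧
      (bohr Γ (x - ε * ρ / 2)).card < (bohr Γ (x + ε * ρ / 2)).card) := by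
    intro ρ
    by_cases hρ : ρ ∈ Set.Icc (r / 2) r
    · obtain ⟨ε, x, h⟩ := exists_growth_of_not_isRegular hΓ (hpos ρ hρ) (hbad ρ hρ)
      exact ⟨ε, x, fun _ => h⟩
    · exact ⟨0, 0, fun h => absurd h hρ⟩
  choose ε x hεx using hch
  obtain ⟨u, hut, hdisj, hcov⟩ := Vitali.exists_disjoint_subfamily_covering_enlargement_closedBall
    (Set.Icc (r / 2) r) x (fun ρ => ε ρ * ρ / 2) r (fun ρ hρ => by
      obtain ⟨h1, h2, -⟩ := hεx ρ hρ
      have := hpos ρ hρ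
      have h3 := hρ.2
      nlinarith) 4 (by norm_num)
  simp only [Real.closedBall_eq_Icc] at hdisj hcov
  -- distinct selected intervals contain the sizes of distinct points of the finite group
  have hfin : u.Finite := by
    have hex : ∀ ρ : u, ∃ y, y ∈ bohr Γ (x ρ + ε ρ * ρ / 2) ∧ y ∉ bohr Γ (x ρ - ε ρ * ρ / 2) := by
      intro ρ
      obtain ⟨-, -, -, -, h⟩ := hεx ρ (hut ρ.2)
      exact exists_mem_notMem_of_card_lt_card h
    choose y hy1 hy2 using hex
    have hlt : ∀ ρ ρ' : u, y ρ = y ρ' → x ρ' - ε ρ' * ρ' / 2 ≤ x ρ + ε ρ * ρ / 2 := by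
      intro ρ ρ' h
      by_contra! hlt
      exact hy2 ρ' (h ▸ bohr_mono Γ hlt.le (hy1 ρ))
    have hinj : Function.Injective y := by
      intro ρ ρ' h
      by_contra hne
      have hd := hdisj ρ.2 ρ'.2 (fun h' => hne (Subtype.ext h'))
      have h1 := hlt ρ ρ' h
      have h2 := hlt ρ' ρ h.symm
      have p1 := mul_pos (hεx ρ (hut ρ.2)).1 (hpos ρ (hut ρ.2))
      have p2 := mul_pos (hεx ρ' (hut ρ'.2)).1 (hpos ρ' (hut ρ'.2))
      have hmem : max (x ρ - ε ρ * ρ / 2) (x ρ' - ε ρ' * ρ' / 2)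
          ∈ Set.Icc (x ρ - ε ρ * ρ / 2) (x ρ + ε ρ * ρ / 2) :=
        ⟨le_max_left _ _, max_le (by linarith) h1⟩
      exact Set.disjoint_left.mp hd hmem ⟨le_max_right _ _, max_le h2 (by linarith)⟩
    have := Finite.of_injective y hinj
    exact Set.toFinite u
  lift u to Finset ℝ using hfin
  -- the enlarged intervals cover `[r / 2, r]`
  have hlen : r / 2 ≤ ∑ ρ ∈ u, 4 * (ε ρ * ρ) := by
    have hsub : Set.Icc (r / 2) r ⊆
        ⋃ ρ ∈ u, Set.Icc (x ρ - 4 * (ε ρ * ρ / 2)) (x ρ + 4 * (ε ρ * ρ / 2)) := by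
      intro ρ hρ
      obtain ⟨b, hb, hsubb⟩ := hcov ρ hρ
      simp only [Set.mem_iUnion, exists_prop]
      refine ⟨b, hb, hsubb ?_⟩
      have h3 := (hεx ρ hρ).2.2.1
      rw [abs_le] at h3
      exact ⟨by linarith, by linarith⟩
    have h1 := (MeasureTheory.measure_mono hsub).trans
      (MeasureTheory.measure_biUnion_finset_le (μ := MeasureTheory.volume) u _)
    simp only [Real.volume_Icc] at h1
    rw [← ENNReal.ofReal_sum_of_nonneg] at h1
    · rw [ENNReal.ofReal_le_ofReal_iff'] at h1
      rcases h1 with h1 | h1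
      · calc r / 2 = r - r / 2 := by ring
          _ ≤ _ := h1
          _ = _ := sum_congr rfl fun ρ _ => by ring
      · linarith
    · intro ρ hρ
      have := mul_pos (hεx ρ (hut hρ)).1 (hpos ρ (hut hρ))
      linarith
  have hsum : 1 / 8 ≤ ∑ ρ ∈ u, ε ρ := by
    have h1 : ∑ ρ ∈ u, 4 * (ε ρ * ρ) ≤ ∑ ρ ∈ u, 4 * (ε ρ * r) := by
      refine sum_le_sum fun ρ hρ => ?_
      have := mul_le_mul_of_nonneg_left (hut hρ).2 (hεx ρ (hut hρ)).1.le
      linarith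
    have h2 : ∑ ρ ∈ u, 4 * (ε ρ * r) = 4 * ((∑ ρ ∈ u, ε ρ) * r) := by rw [sum_mul, mul_sum]
    rw [h2] at h1
    refine le_of_mul_le_mul_right ?_ hr
    linarith
  -- the total growth is limited by the doubling bound
  have hgrow := (monotone_log_card_bohr Γ).sum_sub_le_of_pairwiseDisjoint
    (a := fun ρ => x ρ - ε ρ * ρ / 2) (b := fun ρ => x ρ + ε ρ * ρ / 2)
    (A := 0.495 * r) (B := 1.01 * r) u (by linarith)
    (fun ρ hρ => by
      have := mul_pos (hεx ρ (hut hρ)).1 (hpos ρ (hut hρ))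
      linarith)
    (fun ρ hρ => by
      obtain ⟨h1, h2, h3, -⟩ := hεx ρ (hut hρ)
      rw [abs_le] at h3
      have := hpos ρ (hut hρ)
      have := (hut hρ).1
      nlinarith)
    (fun ρ hρ => by
      obtain ⟨h1, h2, h3, -⟩ := hεx ρ (hut hρ)
      rw [abs_le] at h3
      have := hpos ρ (hut hρ)
      have := (hut hρ).2
      nlinarith) hdisj
  have hn : (1 : ℝ) ≤ Γ.card := by exact_mod_cast hΓ.card_pos
  have hlow : 50 * (1 / 8) * (Γ.card : ℝ) ≤
      Real.log (bohr Γ (1.01 * r)).card - Real.log (bohr Γ (0.495 * r)).card := by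
    refine le_trans ?_ hgrow
    calc 50 * (1 / 8) * (Γ.card : ℝ) ≤ 50 * (∑ ρ ∈ u, ε ρ) * Γ.card := by gcongr
      _ = ∑ ρ ∈ u, 50 * ε ρ * Γ.card := by rw [mul_sum, sum_mul]
      _ ≤ _ := sum_le_sum fun ρ hρ => (hεx ρ (hut hρ)).2.2.2.1
  -- the intervals lie in `[0.495 r, 1.01 r]` because `ε ≤ 1 / 100`, and `2 * 1.01 / 0.495 < 5`
  have hcard := card_bohr_le_pow_mul Γ (R := 1.01 * r) (s := 0.495 * r) (by positivity) (m := 5)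
    (by rw [div_le_iff₀ (by positivity)]; push_cast; linarith)
  have hBs : (0 : ℝ) < (bohr Γ (0.495 * r)).card := by
    exact_mod_cast card_bohr_pos Γ (by positivity)
  have hBt : (0 : ℝ) < (bohr Γ (1.01 * r)).card := by
    exact_mod_cast card_bohr_pos Γ (by positivity)
  have hup : Real.log (bohr Γ (1.01 * r)).card - Real.log (bohr Γ (0.495 * r)).card
      ≤ 5 * Γ.card := by
    have h1 : ((bohr Γ (1.01 * r)).card : ℝ) ≤ (11 : ℝ) ^ (2 * Γ.card) * (bohr Γ (0.495 * r)).card := by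
      exact_mod_cast hcard
    have h2 := Real.log_le_log hBt h1
    rw [Real.log_mul (by positivity) hBs.ne', Real.log_pow] at h2
    have h3 : Real.log 11 ≤ 2.5 := by
      rw [Real.log_le_iff_le_exp (by norm_num)]
      have h4 : Real.exp 2.5 ^ 2 = Real.exp 1 ^ 5 := by
        rw [← Real.exp_nat_mul, ← Real.exp_nat_mul]; norm_num
      refine le_of_pow_le_pow_left₀ (n := 2) (by norm_num) (Real.exp_pos _).le ?_
      rw [h4]
      calc (11 : ℝ) ^ 2 ≤ 2.7 ^ 5 := by norm_num
        _ ≤ Real.exp 1 ^ 5 := by gcongr; linarith [Real.exp_one_gt_d9]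
    have h5 := mul_le_mul_of_nonneg_left h3 (by positivity : (0 : ℝ) ≤ 2 * Γ.card)
    push_cast at h2
    linarith
  linarith

lemma ft_mu (B : Finset (Fin d → F)) (ξ : Fin d → F) :
    ft (mu B) ξ = 𝔼 x ∈ B, conj (ch ξ x) := by
  classical
  have hq : ((Fintype.card F : ℂ) ^ d) ≠ 0 := by
    exact_mod_cast (pow_pos Fintype.card_pos d).ne'
  simp only [ft, mu, expect_eq_sum_div_card, card_univ, apply_ite Complex.ofReal, ite_mul,
    Complex.ofReal_zero, zero_mul, sum_ite_mem, univ_inter, ← mul_sum]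
  simp
  field_simp

/-- The Fourier coefficients of the normalized indicator of a Bohr set; they are real. -/
noncomputable def bohrCoeff (Γ : Finset (Fin d → F)) (ρ : ℝ) (ξ : Fin d → F) : ℝ :=
  (ft (mu (bohr Γ ρ)) ξ).re

lemma ft_mu_bohr (Γ : Finset (Fin d → F)) (ρ : ℝ) (ξ : Fin d → F) :
    ft (mu (bohr Γ ρ)) ξ = bohrCoeff Γ ρ ξ := by
  refine (Complex.conj_eq_iff_re.mp ?_).symm
  rw [ft_mu, conj_expect]
  refine expect_nbij' (fun x => -x) (fun x => -x) (fun x hx => neg_mem_bohr hx)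
    (fun x hx => neg_mem_bohr hx) (by simp) (by simp) fun x _ => ?_
  rw [ch_neg_right]

lemma abs_bohrCoeff_le_one (Γ : Finset (Fin d → F)) {ρ : ℝ} (hρ : 0 ≤ ρ) (ξ : Fin d → F) :
    |bohrCoeff Γ ρ ξ| ≤ 1 := by
  refine (Complex.abs_re_le_norm _).trans ?_
  rw [ft_mu]
  refine (norm_expect_le _ _).trans ?_
  simp [expect_const ⟨0, zero_mem_bohr Γ hρ⟩]

lemma bohrCoeff_pow_four_mem (Γ : Finset (Fin d → F)) {ρ : ℝ} (hρ : 0 ≤ ρ) (ξ : Fin d → F) :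
    bohrCoeff Γ ρ ξ ^ 4 ∈ Set.Icc (0 : ℝ) (bohrCoeff Γ ρ ξ ^ 2) ∧ bohrCoeff Γ ρ ξ ^ 2 ≤ 1 := by
  have h : bohrCoeff Γ ρ ξ ^ 2 ≤ 1 := by
    rw [sq_le_one_iff_abs_le_one]
    exact abs_bohrCoeff_le_one Γ hρ ξ
  refine ⟨⟨by positivity, ?_⟩, h⟩
  calc bohrCoeff Γ ρ ξ ^ 4 = bohrCoeff Γ ρ ξ ^ 2 * bohrCoeff Γ ρ ξ ^ 2 := by ring
    _ ≤ _ := mul_le_of_le_one_left (sq_nonneg _) h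

lemma sum_bohrCoeff_sq (Γ : Finset (Fin d → F)) {ρ : ℝ} (hρ : 0 ≤ ρ) :
    ∑ ξ, bohrCoeff Γ ρ ξ ^ 2 = (Fintype.card F : ℝ) ^ d / (bohr Γ ρ).card := by
  classical
  have h := sum_normSq_ft (mu (bohr Γ ρ))
  simp only [ft_mu_bohr, Complex.norm_real, Real.norm_eq_abs, sq_abs] at h
  rw [h]
  have hB : ((bohr Γ ρ).card : ℝ) ≠ 0 := by exact_mod_cast (card_bohr_pos Γ hρ).ne'
  have hq : ((Fintype.card F : ℝ) ^ d) ≠ 0 := by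
    exact_mod_cast (pow_pos Fintype.card_pos d).ne'
  simp only [mu, expect_eq_sum_div_card, ite_pow]
  simp
  field_simp

/-- On the spectrum of a Bohr set the coefficients of `ν_B` are close to `1`. -/
lemma one_sub_le_bohrCoeff_pow_four {Γ : Finset (Fin d → F)} {ρ : ℝ} (hρ0 : 0 ≤ ρ) (hρ1 : ρ ≤ 1)
    {ξ : Fin d → F} (hξ : ξ ∈ Γ) : 1 - 4 * ρ ≤ bohrCoeff Γ ρ ξ ^ 4 := by
  have hne : (bohr Γ ρ).Nonempty := ⟨0, zero_mem_bohr Γ hρ0⟩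
  have h1 : ‖ft (mu (bohr Γ ρ)) ξ - 1‖ ≤ ρ := by
    have : ft (mu (bohr Γ ρ)) ξ - 1 = 𝔼 x ∈ bohr Γ ρ, (conj (ch ξ x) - 1) := by
      rw [ft_mu, expect_sub_distrib, expect_const hne]
    rw [this]
    refine (norm_expect_le _ _).trans ?_
    refine (expect_le_expect (g := fun _ => ρ) fun x hx => ?_).trans_eq (expect_const hne _)
    have h2 : conj (ch ξ x) - 1 = conj (ch ξ x - 1) := by simp
    rw [h2, RCLike.norm_conj]
    exact mem_bohr.mp hx ξ hξ
  have h2 : 1 - ρ ≤ bohrCoeff Γ ρ ξ := by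
    have := (abs_le.mp ((Complex.abs_re_le_norm _).trans h1)).1
    simp only [Complex.sub_re, Complex.one_re] at this
    rw [bohrCoeff]
    linarith
  have h3 := one_add_mul_le_pow (a := -ρ) (by linarith) 4
  calc 1 - 4 * ρ ≤ (1 + -ρ) ^ 4 := by push_cast at h3; linarith
    _ ≤ _ := by gcongr <;> linarith

lemma ft_nu (Γ : Finset (Fin d → F)) (ρ : ℝ) :
    ft (nu (bohr Γ ρ)) = fun ξ => ((bohrCoeff Γ ρ ξ ^ 4 : ℝ) : ℂ) := by
  ext ξ
  simp only [nu, ft_convolve, Pi.mul_apply, ft_mu_bohr]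
  push_cast
  ring

lemma convolve_nonneg {g h : (Fin d → F) → ℝ} (hg : ∀ x, 0 ≤ g x) (hh : ∀ x, 0 ≤ h x)
    (x : Fin d → F) : 0 ≤ convolve g h x :=
  expect_nonneg fun y _ => mul_nonneg (hg y) (hh _)

lemma mu_nonneg (B : Finset (Fin d → F)) (x : Fin d → F) : 0 ≤ mu B x := by
  rw [mu]; split_ifs <;> positivity

lemma nu_nonneg (B : Finset (Fin d → F)) (x : Fin d → F) : 0 ≤ nu B x :=
  convolve_nonneg (convolve_nonneg (convolve_nonneg (mu_nonneg B) (mu_nonneg B)) (mu_nonneg B))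
    (mu_nonneg B) x

lemma expect_nu (Γ : Finset (Fin d → F)) {ρ : ℝ} (hρ : 0 ≤ ρ) : 𝔼 x, nu (bohr Γ ρ) x = 1 := by
  have h1 : ft (mu (bohr Γ ρ)) 0 = 1 := by
    rw [ft_mu]
    simp [expect_const ⟨0, zero_mem_bohr Γ hρ⟩]
  have h2 : ft (nu (bohr Γ ρ)) 0 = 1 := by
    simp [nu, ft_convolve, h1]
  apply Complex.ofReal_injective
  rw [Complex.ofReal_expect, Complex.ofReal_one, ← h2, ft]
  simp

/-! ### Energy increment and decomposition -/

/-- One step of the energy increment: if `Γ'` contains the frequencies at which `μ_B` is not small,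
then passing from `B = B(Γ, ρ)` to `B(Γ', ρ')` nearly increases the energy
`∑ ν̂_B |ft g|²`, and the change of `ν_B * g` is controlled by the gain. -/
lemma sum_sq_sub_le_energy_sub (g : (Fin d → F) → ℝ)
    {Γ Γ' : Finset (Fin d → F)} {ρ ρ' α : ℝ} (hρ : 0 ≤ ρ) (hρ' : 0 ≤ ρ') (hρ1 : ρ' ≤ 1)
    (hα : 0 ≤ α) (hα' : 4 * ρ' ≤ α ^ 4) (hsub : spec (mu (bohr Γ ρ)) α ⊆ Γ') :
    ∑ ξ, (bohrCoeff Γ' ρ' ξ ^ 4 - bohrCoeff Γ ρ ξ ^ 4) ^ 2 * ‖ft g ξ‖ ^ 2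
      ≤ ∑ ξ, bohrCoeff Γ' ρ' ξ ^ 4 * ‖ft g ξ‖ ^ 2 - ∑ ξ, bohrCoeff Γ ρ ξ ^ 4 * ‖ft g ξ‖ ^ 2
        + 2 * α ^ 2 * ∑ ξ, bohrCoeff Γ ρ ξ ^ 2 * ‖ft g ξ‖ ^ 2 := by
  rw [mul_sum, ← sum_sub_distrib, ← sum_add_distrib]
  refine sum_le_sum fun ξ _ => ?_
  rw [← sub_mul, ← mul_assoc, ← add_mul]
  refine mul_le_mul_of_nonneg_right ?_ (sq_nonneg _)
  obtain ⟨⟨ha0, ha⟩, ha1⟩ := bohrCoeff_pow_four_mem Γ hρ ξ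
  obtain ⟨⟨hb0, hb⟩, hb1⟩ := bohrCoeff_pow_four_mem Γ' hρ' ξ
  -- the only way to lose energy is by a small multiple of the squared coefficient of `μ_B`
  have hloss : bohrCoeff Γ ρ ξ ^ 4 - bohrCoeff Γ' ρ' ξ ^ 4 ≤ α ^ 2 * bohrCoeff Γ ρ ξ ^ 2 := by
    by_cases hξ : ξ ∈ spec (mu (bohr Γ ρ)) α
    · have h1 := one_sub_le_bohrCoeff_pow_four hρ' hρ1 (hsub hξ)
      simp only [spec, mem_filter, mem_univ, true_and, ft_mu_bohr, Complex.norm_real,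
        Real.norm_eq_abs] at hξ
      have h2 : α ^ 2 ≤ bohrCoeff Γ ρ ξ ^ 2 := by
        rw [← sq_abs (bohrCoeff Γ ρ ξ)]; gcongr
      have h3 := mul_le_mul_of_nonneg_left h2 (sq_nonneg α)
      have h4 : α ^ 4 = α ^ 2 * α ^ 2 := by ring
      linarith
    · simp only [spec, mem_filter, mem_univ, true_and, ft_mu_bohr, Complex.norm_real,
        Real.norm_eq_abs, not_le] at hξ
      have h2 : bohrCoeff Γ ρ ξ ^ 2 ≤ α ^ 2 := by
        rw [← sq_abs (bohrCoeff Γ ρ ξ)]; gcongr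
      have h3 := mul_le_mul_of_nonneg_right h2 (sq_nonneg (bohrCoeff Γ ρ ξ))
      have h4 : bohrCoeff Γ ρ ξ ^ 4 = bohrCoeff Γ ρ ξ ^ 2 * bohrCoeff Γ ρ ξ ^ 2 := by ring
      linarith
  have key : ∀ a b t : ℝ, 0 ≤ a → a ≤ 1 → 0 ≤ b → b ≤ 1 → 0 ≤ t → a - b ≤ t →
      (b - a) ^ 2 ≤ b - a + 2 * t := by
    intro a b t ha0 ha1 hb0 hb1 ht hab
    rcases le_total a b with h | h <;> nlinarith
  rw [mul_assoc]
  exact key _ _ _ ha0 (ha.trans ha1) hb0 (hb.trans hb1)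
    (mul_nonneg (sq_nonneg _) (sq_nonneg _)) hloss

namespace IsPseudorandom

variable {σ : (Fin d → F) → ℝ} {κ : ℝ}

/-- Smoothing by `ν_B` turns `f σ` into an essentially `1`-bounded function. -/
lemma abs_convolve_nu_le (h : IsPseudorandom σ κ) {f : (Fin d → F) → ℝ} (hf : ∀ x, |f x| ≤ 1)
    {Γ : Finset (Fin d → F)} {ρ P : ℝ} (hρ : 0 ≤ ρ) (hP : ∑ ξ, bohrCoeff Γ ρ ξ ^ 2 ≤ P)
    (x : Fin d → F) : |convolve (nu (bohr Γ ρ)) (f * σ) x| ≤ 1 + κ * P := by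
  have h1 : |convolve (nu (bohr Γ ρ)) (f * σ) x| ≤ convolve (nu (bohr Γ ρ)) σ x := by
    refine (abs_expect_le _ _).trans (expect_le_expect fun y _ => ?_)
    rw [abs_mul, abs_of_nonneg (nu_nonneg _ _), Pi.mul_apply, abs_mul, abs_of_nonneg (h.1 _)]
    exact mul_le_mul_of_nonneg_left (mul_le_of_le_one_left (h.1 _) (hf _)) (nu_nonneg _ _)
  have h2 : convolve (nu (bohr Γ ρ)) (σ - 1) x = convolve (nu (bohr Γ ρ)) σ x - 1 := by
    rw [← expect_nu Γ hρ, convolve, convolve, ← expect_sub_distrib]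
    exact expect_congr rfl fun y _ => by simp [mul_sub]
  have h3 : |convolve (nu (bohr Γ ρ)) (σ - 1) x| ≤ κ * P := by
    rw [← Real.norm_eq_abs, ← Complex.norm_real, convolve_eq_synth]
    refine (norm_sum_le _ _).trans ?_
    refine le_trans ?_ (mul_le_mul_of_nonneg_left hP h.nonneg_const)
    rw [mul_sum]
    refine sum_le_sum fun ξ _ => ?_
    have hb := (bohrCoeff_pow_four_mem Γ hρ ξ).1
    simp only [ft_nu]
    rw [norm_mul, norm_ch, mul_one, norm_mul, Complex.norm_real, Real.norm_of_nonneg hb.1, mul_comm]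
    exact mul_le_mul (h.2 ξ) hb.2 hb.1 h.nonneg_const
  rw [h2] at h3
  linarith [le_abs_self (convolve (nu (bohr Γ ρ)) σ x - 1)]

/-- The decomposition attached to two Bohr sets. The finer one `B' = B(Γ', ρ')` resolves the large
spectrum of `f σ`, so `f - ν_{B'} * (f σ)` is uniform; the coarser one differs from it little in
`L²`. Shrinking `ν_{B'} * (f σ)` by a factor `1 - s` makes room for the error with which it is
bounded by `1`. -/
lemma exists_decomposition (h : IsPseudorandom σ κ) {Q : ℝ} (hQ : ∀ x, σ x ≤ Q)
    {f : (Fin d → F) → ℝ} (hf : ∀ x, |f x| ≤ 1) {Γ Γ' : Finset (Fin d → F)}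
    {ρ ρ' P s ε D : ℝ} (hρ : 0 ≤ ρ) (hρ' : 0 ≤ ρ') (hρ1 : ρ' ≤ 1)
    (hP : ∑ ξ, bohrCoeff Γ ρ ξ ^ 2 ≤ P) (hP' : ∑ ξ, bohrCoeff Γ' ρ' ξ ^ 2 ≤ P)
    (hκ : κ ≤ 1) (hs0 : 0 ≤ s) (hs1 : s ≤ 1) (hκP : κ * P ≤ s / 2)
    (hε : 8 * ρ' ≤ ε) (hspec : spec (f * σ) ε ⊆ Γ')
    (hD : ∑ ξ, (bohrCoeff Γ' ρ' ξ ^ 4 - bohrCoeff Γ ρ ξ ^ 4) ^ 2 * ‖ft (f * σ) ξ‖ ^ 2 ≤ D) :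
    ∃ f₂ f₃ : (Fin d → F) → ℝ, (∀ x, |f₂ x| ≤ 2) ∧ (∀ x, |f₃ x| ≤ 2) ∧
      f = convolve (nu (bohr Γ ρ)) (f * σ) + f₂ + f₃ ∧
      ∑ ξ, ‖ft (f₂ * σ) ξ‖ ^ 4 ≤ 16 * (ε + 2 * (κ * P) + 4 * s) ^ 2 + 128 * (κ * Q) ∧
      𝔼 x, f₃ x ^ 2 * σ x ≤ 2 * (D + κ * (4 * P) ^ 2) + 16 * s ^ 2 := by
  set f₁ := convolve (nu (bohr Γ ρ)) (f * σ) with hf₁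
  set g := convolve (nu (bohr Γ' ρ')) (f * σ) with hg
  have hb1 : ∀ x, |f₁ x| ≤ 1 + s / 2 := fun x =>
    (h.abs_convolve_nu_le hf hρ hP x).trans (by linarith)
  have hbg : ∀ x, |g x| ≤ 1 + s / 2 := fun x =>
    (h.abs_convolve_nu_le hf hρ' hP' x).trans (by linarith)
  have hbs : ∀ x, |(1 - s) * g x| ≤ 1 - s / 2 := fun x => by
    rw [abs_mul, abs_of_nonneg (by linarith)]
    have := mul_le_mul_of_nonneg_left (hbg x) (by linarith : 0 ≤ 1 - s)
    nlinarith
  have hF2 : ∀ ξ, ‖ft (f * σ) ξ‖ ≤ 2 := fun ξ => by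
    simpa using h.norm_ft_mul_le hκ hf zero_le_one ξ
  have hgsynth : ∀ x, (g x : ℂ) = synth (fun ξ => (bohrCoeff Γ' ρ' ξ ^ 4 : ℝ) * ft (f * σ) ξ) x := by
    intro x
    rw [hg, convolve_eq_synth, ft_nu]
  have hfsynth : ∀ x, (f₁ x : ℂ) = synth (fun ξ => (bohrCoeff Γ ρ ξ ^ 4 : ℝ) * ft (f * σ) ξ) x := by
    intro x
    rw [hf₁, convolve_eq_synth, ft_nu]
  have hsum : ∀ (Γ : Finset (Fin d → F)) (ρ : ℝ), 0 ≤ ρ → ∑ ξ, bohrCoeff Γ ρ ξ ^ 2 ≤ P →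
      ∑ ξ, bohrCoeff Γ ρ ξ ^ 4 * ‖ft (f * σ) ξ‖ ≤ 2 * P := by
    intro Γ ρ hρ hP
    refine le_trans ?_ (mul_le_mul_of_nonneg_left hP zero_le_two)
    rw [mul_sum]
    refine sum_le_sum fun ξ _ => ?_
    have hb := (bohrCoeff_pow_four_mem Γ hρ ξ).1
    rw [mul_comm]
    exact mul_le_mul (hF2 ξ) hb.2 hb.1 zero_le_two
  have hbf₂ : ∀ x, |f x - (1 - s) * g x| ≤ 2 := fun x =>
    (abs_sub _ _).trans (by linarith [hf x, hbs x])
  refine ⟨fun x => f x - (1 - s) * g x, fun x => (1 - s) * g x - f₁ x, hbf₂,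
    fun x => (abs_sub _ _).trans (by linarith [hbs x, hb1 x]), ?_, ?_, ?_⟩
  · ext x
    simp only [Pi.add_apply]
    ring
  · have hM : 𝔼 x, (f x - (1 - s) * g x) ^ 2 * σ x ≤ 8 := by
      have := h.expect_mul_le hκ (g := fun x => (f x - (1 - s) * g x) ^ 2) (M := 4)
        (fun x => by
          rw [← sq_abs]
          calc _ ≤ (2 : ℝ) ^ 2 := by gcongr; exact hbf₂ x
            _ = 4 := by norm_num) (by norm_num)
      linarith
    have hθ : ∀ ξ, ‖ft ((fun x => f x - (1 - s) * g x) * σ) ξ‖ ≤ ε + 2 * (κ * P) + 4 * s := by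
      intro ξ
      have e1 : ((fun x => f x - (1 - s) * g x) * σ : (Fin d → F) → ℝ)
          = f * σ - g * σ + s • (g * σ) := by
        ext x
        simp only [Pi.mul_apply, Pi.sub_apply, Pi.add_apply, Pi.smul_apply, smul_eq_mul]
        ring
      have e2 : ft ((fun x => f x - (1 - s) * g x) * σ) ξ
          = ((1 - bohrCoeff Γ' ρ' ξ ^ 4 : ℝ) : ℂ) * ft (f * σ) ξ
            - (ft (g * σ) ξ - (bohrCoeff Γ' ρ' ξ ^ 4 : ℝ) * ft (f * σ) ξ)
            + (s : ℂ) * ft (g * σ) ξ := by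
        rw [e1, ft_add, ft_sub, ft_smul]
        simp only [Pi.add_apply, Pi.sub_apply, Pi.smul_apply, smul_eq_mul]
        push_cast
        ring
      rw [e2]
      have hb := bohrCoeff_pow_four_mem Γ' hρ' ξ
      have n1 : ‖((1 - bohrCoeff Γ' ρ' ξ ^ 4 : ℝ) : ℂ) * ft (f * σ) ξ‖ ≤ ε := by
        rw [norm_mul, Complex.norm_real, Real.norm_of_nonneg (by linarith [hb.1.2, hb.2])]
        by_cases hξ : ξ ∈ spec (f * σ) ε
        · have h1 := one_sub_le_bohrCoeff_pow_four hρ' hρ1 (hspec hξ)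
          calc _ ≤ 4 * ρ' * 2 := mul_le_mul (by linarith) (hF2 ξ) (norm_nonneg _) (by linarith)
            _ ≤ ε := by linarith
        · simp only [spec, mem_filter, mem_univ, true_and, not_le] at hξ
          refine le_trans (mul_le_of_le_one_left (norm_nonneg _) (by linarith [hb.1.1])) hξ.le
      have n2 : ‖ft (g * σ) ξ - (bohrCoeff Γ' ρ' ξ ^ 4 : ℝ) * ft (f * σ) ξ‖ ≤ 2 * (κ * P) := by
        refine (h.norm_ft_mul_sub_le hgsynth ξ).trans ?_
        have h1 := mul_le_mul_of_nonneg_left (hsum Γ' ρ' hρ' hP') h.nonneg_const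
        refine le_trans (le_of_eq ?_) (h1.trans_eq (by ring))
        congr 1
        refine sum_congr rfl fun ζ _ => ?_
        rw [norm_mul, Complex.norm_real,
          Real.norm_of_nonneg (bohrCoeff_pow_four_mem Γ' hρ' ζ).1.1]
      have n3 : ‖(s : ℂ) * ft (g * σ) ξ‖ ≤ 4 * s := by
        rw [norm_mul, Complex.norm_real, Real.norm_of_nonneg hs0]
        have := h.norm_ft_mul_le hκ (g := g) (M := 2) (fun x => (hbg x).trans (by linarith))
          zero_le_two ξ
        nlinarith
      exact (norm_add_le _ _).trans (add_le_add ((norm_sub_le _ _).trans (add_le_add n1 n2)) n3)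
    refine (h.sum_ft_pow_four_le hM hQ hθ).trans (le_of_eq ?_)
    norm_num
  · let a : (Fin d → F) → ℂ := fun ξ =>
      (bohrCoeff Γ' ρ' ξ ^ 4 - bohrCoeff Γ ρ ξ ^ 4 : ℝ) * ft (f * σ) ξ
    have ha : ∀ ξ, ‖a ξ‖ = |bohrCoeff Γ' ρ' ξ ^ 4 - bohrCoeff Γ ρ ξ ^ 4| * ‖ft (f * σ) ξ‖ := by
      intro ξ
      simp only [a]
      rw [norm_mul, Complex.norm_real, Real.norm_eq_abs]
    have hsynth : ∀ x, ((g x - f₁ x : ℝ) : ℂ) = synth a x := by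
      intro x
      rw [Complex.ofReal_sub, hgsynth, hfsynth, ← synth_sub]
      congr 1
      ext ξ
      simp only [a, Pi.sub_apply]
      push_cast
      ring
    have h1 : ∑ ξ, ‖a ξ‖ ^ 2 ≤ D := by
      refine le_trans (le_of_eq (sum_congr rfl fun ξ _ => ?_)) hD
      rw [ha, mul_pow, sq_abs]
    have h2 : ∑ ξ, ‖a ξ‖ ≤ 4 * P := by
      have : ∀ ξ, ‖a ξ‖ ≤ bohrCoeff Γ' ρ' ξ ^ 4 * ‖ft (f * σ) ξ‖
          + bohrCoeff Γ ρ ξ ^ 4 * ‖ft (f * σ) ξ‖ := by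
        intro ξ
        rw [ha, ← add_mul]
        refine mul_le_mul_of_nonneg_right ((abs_sub _ _).trans (le_of_eq ?_)) (norm_nonneg _)
        rw [abs_of_nonneg (by positivity), abs_of_nonneg (by positivity)]
      refine (sum_le_sum fun ξ _ => this ξ).trans ?_
      rw [sum_add_distrib]
      linarith [hsum Γ ρ hρ hP, hsum Γ' ρ' hρ' hP']
    have h3 : 𝔼 x, (g x - f₁ x) ^ 2 * σ x ≤ D + κ * (4 * P) ^ 2 := by
      have h4 := h.expect_normSq_synth_le a
      simp only [← hsynth, Complex.norm_real, Real.norm_eq_abs, sq_abs] at h4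
      refine h4.trans (add_le_add h1 (mul_le_mul_of_nonneg_left ?_ h.nonneg_const))
      have := sum_nonneg fun ξ (_ : ξ ∈ univ) => norm_nonneg (a ξ)
      gcongr
    have h5 : 𝔼 x, g x ^ 2 * σ x ≤ 8 := by
      have := h.expect_mul_le hκ (g := fun x => g x ^ 2) (M := 4)
        (fun x => by
          rw [← sq_abs]
          calc _ ≤ (2 : ℝ) ^ 2 := by gcongr; linarith [hbg x]
            _ = 4 := by norm_num) (by norm_num)
      linarith
    calc 𝔼 x, ((1 - s) * g x - f₁ x) ^ 2 * σ x
        ≤ 𝔼 x, (2 * ((g x - f₁ x) ^ 2 * σ x) + 2 * s ^ 2 * (g x ^ 2 * σ x)) := by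
          refine expect_le_expect fun x _ => ?_
          have := mul_nonneg (sq_nonneg (g x - f₁ x + s * g x)) (h.1 x)
          nlinarith
      _ = 2 * 𝔼 x, (g x - f₁ x) ^ 2 * σ x + 2 * s ^ 2 * 𝔼 x, g x ^ 2 * σ x := by
          rw [expect_add_distrib, mul_expect, mul_expect]
      _ ≤ 2 * (D + κ * (4 * P) ^ 2) + 2 * s ^ 2 * 8 := by gcongr
      _ = _ := by ring

end IsPseudorandom

/-! ### The iteration -/

lemma uPerpNorm_le {lam : F} {f : (Fin d → F) → ℝ} {t : ℝ} (ht : 0 ≤ t)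
    (h : ∑ ξ, ‖ft (f * sphereMeasure lam) ξ‖ ^ 4 ≤ t ^ 4) : uPerpNorm lam f ≤ t := by
  have h1 := expect_box_eq_sum_ft_pow_four (f * sphereMeasure lam)
  simp only [Pi.mul_apply] at h1
  rw [uPerpNorm, h1]
  calc _ ≤ (t ^ 4) ^ (1 / 4 : ℝ) := Real.rpow_le_rpow (by positivity) h (by norm_num)
    _ = t := by
      rw [← Real.rpow_natCast, ← Real.rpow_mul ht]
      norm_num

/-- The level of the large spectrum to be resolved after a Bohr set of rank at most `p.1` and
radius at least `p.2`. -/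
noncomputable def specLevel (φ : ℝ → ℝ → ℝ) (p : ℕ × ℝ) : ℝ := φ (p.1 : ℝ)⁻¹ p.2 ^ 2 / 16

/-- The bounds for the rank (from above) and the radius (from below) of the `n`-th Bohr set of the
iteration. They depend only on the growth function `φ` and the threshold `α`. -/
noncomputable def rankRadius (φ : ℝ → ℝ → ℝ) (α : ℝ) : ℕ → ℕ × ℝ
  | 0 => (1, 1 / 2)
  | n + 1 =>
    let p := rankRadius φ α n
    (p.1 + 1 + ⌈4 / specLevel φ p ^ 2⌉₊ + ⌈(11 / p.2) ^ (2 * p.1) / α ^ 2⌉₊,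
      min p.2 (min (α ^ 4 / 4) (specLevel φ p / 8)) / 2)

section Parameters

variable {φ : ℝ → ℝ → ℝ} {α : ℝ}

lemma inv_natCast_mem_Ioc {n : ℕ} (hn : 1 ≤ n) : (n : ℝ)⁻¹ ∈ Set.Ioc (0 : ℝ) 1 :=
  ⟨by positivity, inv_le_one_of_one_le₀ (by exact_mod_cast hn)⟩

lemma rankRadius_mem (hφ : ∀ s ∈ Set.Ioc (0 : ℝ) 1, ∀ t ∈ Set.Ioc (0 : ℝ) 1,
    φ s t ∈ Set.Ioo (0 : ℝ) 1) (hα : 0 < α) (n : ℕ) :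
    1 ≤ (rankRadius φ α n).1 ∧ (rankRadius φ α n).2 ∈ Set.Ioc (0 : ℝ) 1 := by
  induction n with
  | zero => exact ⟨le_rfl, by norm_num [rankRadius]⟩
  | succ n ih =>
    obtain ⟨h1, h2⟩ := ih
    have h3 : 0 < specLevel φ (rankRadius φ α n) :=
      div_pos (pow_pos (hφ _ (inv_natCast_mem_Ioc h1) _ h2).1 2) (by norm_num)
    refine ⟨?_, ?_, ?_⟩
    · simp only [rankRadius]; omega
    · simp only [rankRadius]
      have h4 : 0 < min (rankRadius φ α n).2 (min (α ^ 4 / 4) (specLevel φ (rankRadius φ α n) / 8)) :=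
        lt_min h2.1 (lt_min (by positivity) (by positivity))
      linarith
    · simp only [rankRadius]
      have := min_le_left (rankRadius φ α n).2
        (min (α ^ 4 / 4) (specLevel φ (rankRadius φ α n) / 8))
      linarith [h2.2]

lemma monotone_rankRadius_fst : Monotone fun n => (rankRadius φ α n).1 :=
  monotone_nat_of_le_succ fun n => by simp only [rankRadius]; omega

lemma antitone_rankRadius_snd (hφ : ∀ s ∈ Set.Ioc (0 : ℝ) 1, ∀ t ∈ Set.Ioc (0 : ℝ) 1,
    φ s t ∈ Set.Ioo (0 : ℝ) 1) (hα : 0 < α) : Antitone fun n => (rankRadius φ α n).2 :=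
  antitone_nat_of_succ_le fun n => by
    have h := (rankRadius_mem hφ hα n).2.1
    simp only [rankRadius]
    have := min_le_left (rankRadius φ α n).2
      (min (α ^ 4 / 4) (specLevel φ (rankRadius φ α n) / 8))
    linarith

end Parameters

/-- The chain of Bohr sets: each spectrum contains the large spectrum of `f σ` and the frequencies
at which the preceding Bohr set has a coefficient of size at least `α`. -/
lemma IsPseudorandom.exists_bohr_sequence {σ f : (Fin d → F) → ℝ} {κ : ℝ} (h : IsPseudorandom σ κ)
    (hf : 𝔼 x, f x ^ 2 * σ x ≤ 2) {φ : ℝ → ℝ → ℝ} {α : ℝ}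
    (hφ : ∀ s ∈ Set.Ioc (0 : ℝ) 1, ∀ t ∈ Set.Ioc (0 : ℝ) 1, φ s t ∈ Set.Ioo (0 : ℝ) 1)
    (hα : 0 < α) (J : ℕ) (hκ : ∀ i < J, 4 * κ ≤ specLevel φ (rankRadius φ α i) ^ 2) :
    ∃ (Γ : ℕ → Finset (Fin d → F)) (ρ : ℕ → ℝ),
      (∀ i, (Γ i).Nonempty ∧ IsRegular (Γ i) (ρ i) ∧ (rankRadius φ α i).2 ≤ ρ i ∧ ρ i ≤ 1) ∧
      (∀ i, spec (f * σ) (specLevel φ (rankRadius φ α i)) ⊆ Γ (i + 1) ∧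
        spec (mu (bohr (Γ i) (ρ i))) α ⊆ Γ (i + 1) ∧
        8 * ρ (i + 1) ≤ specLevel φ (rankRadius φ α i) ∧ 4 * ρ (i + 1) ≤ α ^ 4) ∧
      ∀ i ≤ J, (Γ i).card ≤ (rankRadius φ α i).1 := by
  classical
  -- `0` is inserted to keep the spectra nonempty, as the choice of a regular radius requires
  have hstep : ∀ (i : ℕ) (p : Finset (Fin d → F) × ℝ), ∃ p' : Finset (Fin d → F) × ℝ,
      p'.1 = insert 0 (spec (f * σ) (specLevel φ (rankRadius φ α i)) ∪ spec (mu (bohr p.1 p.2)) α) ∧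
      p'.2 ∈ Set.Icc (2 * (rankRadius φ α (i + 1)).2 / 2) (2 * (rankRadius φ α (i + 1)).2) ∧
      IsRegular p'.1 p'.2 := by
    intro i p
    obtain ⟨ρ, hρ, hreg⟩ := exists_isRegular (insert_nonempty 0
      (spec (f * σ) (specLevel φ (rankRadius φ α i)) ∪ spec (mu (bohr p.1 p.2)) α))
      (r := 2 * (rankRadius φ α (i + 1)).2) (by linarith [(rankRadius_mem hφ hα (i + 1)).2.1])
    exact ⟨⟨_, ρ⟩, rfl, hρ, hreg⟩
  choose next hn1 hn2 hn3 using hstep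
  obtain ⟨ρ₀, hρ₀, hreg₀⟩ := exists_isRegular (singleton_nonempty (0 : Fin d → F))
    (r := 1) one_pos
  let S : ℕ → Finset (Fin d → F) × ℝ := fun n => Nat.rec ({0}, ρ₀) next n
  have hS : ∀ n, S (n + 1) = next n (S n) := fun n => rfl
  have hrad : ∀ i, 2 * (rankRadius φ α (i + 1)).2 = min (rankRadius φ α i).2
      (min (α ^ 4 / 4) (specLevel φ (rankRadius φ α i) / 8)) := fun i => by
    simp only [rankRadius]; ring
  have hA : ∀ i, (S i).1.Nonempty ∧ IsRegular (S i).1 (S i).2 ∧ (rankRadius φ α i).2 ≤ (S i).2 ∧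
      (S i).2 ≤ 1 := by
    intro i
    cases i with
    | zero => exact ⟨singleton_nonempty _, hreg₀, hρ₀.1, hρ₀.2⟩
    | succ i =>
      have h1 := (hn2 i (S i)).1
      have h2 := (hn2 i (S i)).2
      rw [hrad] at h2
      rw [hS]
      refine ⟨by rw [hn1]; exact insert_nonempty _ _, hn3 _ _, by linarith, ?_⟩
      exact h2.trans ((min_le_left _ _).trans (rankRadius_mem hφ hα i).2.2)
  refine ⟨fun n => (S n).1, fun n => (S n).2, hA, fun i => ?_, fun i hi => ?_⟩
  · have h2 := (hn2 i (S i)).2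
    rw [hrad, le_min_iff, le_min_iff] at h2
    simp only [hS]
    rw [hn1]
    refine ⟨?_, ?_, by linarith [h2.2.2], by linarith [h2.2.1]⟩
    · exact subset_union_left.trans (subset_insert _ _)
    · exact subset_union_right.trans (subset_insert _ _)
  · induction i with
    | zero => simp [S, rankRadius]
    | succ i ih =>
      have ih : (S i).1.card ≤ (rankRadius φ α i).1 := ih (by omega)
      obtain ⟨hC, hc⟩ := rankRadius_mem hφ hα i
      have hlev : 0 < specLevel φ (rankRadius φ α i) :=
        div_pos (pow_pos (hφ _ (inv_natCast_mem_Ioc hC) _ hc).1 2) (by norm_num)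
      have c1 : (spec (f * σ) (specLevel φ (rankRadius φ α i))).card
          ≤ ⌈4 / specLevel φ (rankRadius φ α i) ^ 2⌉₊ := by
        have h1 := h.card_spec_mul_sq_le hf hlev.le (by linarith [hκ i (by omega)])
        have h2 := (le_div_iff₀ (by positivity)).mpr h1
        rw [show (2 : ℝ) * 2 = 4 by norm_num] at h2
        exact_mod_cast h2.trans (Nat.le_ceil _)
      have c2 : (spec (mu (bohr (S i).1 (S i).2)) α).card
          ≤ ⌈(11 / (rankRadius φ α i).2) ^ (2 * (rankRadius φ α i).1) / α ^ 2⌉₊ := by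
        obtain ⟨-, -, hlow, hle⟩ := hA i
        have hρpos : 0 < (S i).2 := hc.1.trans_le hlow
        have h1 : ((spec (mu (bohr (S i).1 (S i).2)) α).card : ℝ) * α ^ 2
            ≤ ∑ ξ, bohrCoeff (S i).1 (S i).2 ξ ^ 2 := by
          rw [← nsmul_eq_mul]
          refine (card_nsmul_le_sum _ _ _ fun ξ hξ => ?_).trans
            (sum_le_sum_of_subset_of_nonneg (subset_univ _) fun _ _ _ => sq_nonneg _)
          simp only [spec, mem_filter, mem_univ, true_and, ft_mu_bohr, Complex.norm_real,
            Real.norm_eq_abs] at hξ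
          rw [← sq_abs (bohrCoeff _ _ ξ)]
          gcongr
        rw [sum_bohrCoeff_sq _ hρpos.le] at h1
        have h2 := h1.trans (card_div_card_bohr_le (S i).1 hρpos hle)
        have h3 : (11 / (S i).2) ^ (2 * (S i).1.card)
            ≤ (11 / (rankRadius φ α i).2) ^ (2 * (rankRadius φ α i).1) := by
          have h4 : 11 / (S i).2 ≤ 11 / (rankRadius φ α i).2 :=
            div_le_div_of_nonneg_left (by norm_num) hc.1 hlow
          have h5 : 1 ≤ 11 / (rankRadius φ α i).2 := by
            rw [le_div_iff₀ hc.1]; linarith [hc.2]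
          calc _ ≤ (11 / (rankRadius φ α i).2) ^ (2 * (S i).1.card) := by gcongr
            _ ≤ _ := pow_le_pow_right₀ h5 (by omega)
        have h6 := (le_div_iff₀ (by positivity)).mpr (h2.trans h3)
        exact_mod_cast h6.trans (Nat.le_ceil _)
      simp only [hS]
      rw [hn1]
      simp only [rankRadius]
      have c3 := card_insert_le (0 : Fin d → F)
        (spec (f * σ) (specLevel φ (rankRadius φ α i)) ∪ spec (mu (bohr (S i).1 (S i).2)) α)
      have c4 := card_union_le (spec (f * σ) (specLevel φ (rankRadius φ α i)))
        (spec (mu (bohr (S i).1 (S i).2)) α)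
      omega

/-- Pigeonholing the bounded energies along a chain of Bohr sets. -/
lemma IsPseudorandom.exists_small_increment {σ f : (Fin d → F) → ℝ} {κ : ℝ}
    (h : IsPseudorandom σ κ) (hf : 𝔼 x, f x ^ 2 * σ x ≤ 2) {α η P : ℝ} (hα : 0 < α)
    (hη : 0 < η) (hαη : 12 * α = η) {J : ℕ} (hJ : 64 / η ^ 2 ≤ J)
    {Γ : ℕ → Finset (Fin d → F)} {ρ : ℕ → ℝ} (hρ : ∀ i, 0 ≤ ρ i ∧ ρ i ≤ 1)
    (hP : ∀ i ≤ J, ∑ ξ, bohrCoeff (Γ i) (ρ i) ξ ^ 2 ≤ P) (hκP : κ * P ≤ 1)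
    (hstep : ∀ i, spec (mu (bohr (Γ i) (ρ i))) α ⊆ Γ (i + 1) ∧ 4 * ρ (i + 1) ≤ α ^ 4) :
    ∃ i < J, ∑ ξ, (bohrCoeff (Γ (i + 1)) (ρ (i + 1)) ξ ^ 4 - bohrCoeff (Γ i) (ρ i) ξ ^ 4) ^ 2
      * ‖ft (f * σ) ξ‖ ^ 2 ≤ η ^ 2 / 8 := by
  have hJ0 : (0 : ℝ) < J := lt_of_lt_of_le (by positivity) hJ
  have hJ0' : 0 < J := by exact_mod_cast hJ0
  let E : ℕ → ℝ := fun i => ∑ ξ, bohrCoeff (Γ i) (ρ i) ξ ^ 4 * ‖ft (f * σ) ξ‖ ^ 2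
  have hsq : ∀ i ≤ J, ∑ ξ, bohrCoeff (Γ i) (ρ i) ξ ^ 2 * ‖ft (f * σ) ξ‖ ^ 2 ≤ 4 := by
    intro i hi
    have h1 := h.sum_mul_normSq_ft_le hf (w := fun ξ => bohrCoeff (Γ i) (ρ i) ξ ^ 2)
      (fun ξ => sq_nonneg _) (fun ξ => (bohrCoeff_pow_four_mem (Γ i) (hρ i).1 ξ).2)
    have h2 := mul_le_mul_of_nonneg_left (hP i hi) h.nonneg_const
    linarith
  have hE0 : 0 ≤ E 0 := sum_nonneg fun ξ _ =>
    mul_nonneg (bohrCoeff_pow_four_mem (Γ 0) (hρ 0).1 ξ).1.1 (sq_nonneg _)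
  have hEJ : E J ≤ 4 := (sum_le_sum fun ξ _ => mul_le_mul_of_nonneg_right
    (bohrCoeff_pow_four_mem (Γ J) (hρ J).1 ξ).1.2 (sq_nonneg _)).trans (hsq J le_rfl)
  have hinc : ∀ i < J, ∑ ξ, (bohrCoeff (Γ (i + 1)) (ρ (i + 1)) ξ ^ 4
      - bohrCoeff (Γ i) (ρ i) ξ ^ 4) ^ 2 * ‖ft (f * σ) ξ‖ ^ 2 ≤ E (i + 1) - E i + 8 * α ^ 2 := by
    intro i hi
    have h1 := sum_sq_sub_le_energy_sub (f * σ) (hρ i).1 (hρ (i + 1)).1 (hρ (i + 1)).2 hα.le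
      (hstep i).2 (hstep i).1
    have h2 := mul_le_mul_of_nonneg_left (hsq i hi.le) (by positivity : 0 ≤ 2 * α ^ 2)
    linarith
  have hsum : ∑ i ∈ range J, ∑ ξ, (bohrCoeff (Γ (i + 1)) (ρ (i + 1)) ξ ^ 4
      - bohrCoeff (Γ i) (ρ i) ξ ^ 4) ^ 2 * ‖ft (f * σ) ξ‖ ^ 2 ≤ ∑ _i ∈ range J, η ^ 2 / 8 := by
    refine (sum_le_sum fun i hi => hinc i (mem_range.mp hi)).trans ?_
    rw [sum_add_distrib, sum_range_sub, sum_const, sum_const, card_range, nsmul_eq_mul,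
      nsmul_eq_mul]
    rw [div_le_iff₀ (by positivity)] at hJ
    have : 0 ≤ J * η ^ 2 := by positivity
    subst hαη
    nlinarith
  obtain ⟨i, hi, hle⟩ := exists_le_of_sum_le ⟨0, mem_range.mpr hJ0'⟩ hsum
  exact ⟨i, mem_range.mp hi, hle⟩

end SphereRegularity

theorem mainTheorem4 (η : ℝ) (hη : η ∈ Set.Ioo (0 : ℝ) 1) (φ : ℝ → ℝ → ℝ)
    (hφ : ∀ s ∈ Set.Ioc (0 : ℝ) 1, ∀ t ∈ Set.Ioc (0 : ℝ) 1, φ s t ∈ Set.Ioo (0 : ℝ) 1)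
    (hφ₁ : ∀ t ∈ Set.Ioc (0 : ℝ) 1, MonotoneOn (fun s => φ s t) (Set.Ioc (0 : ℝ) 1))
    (hφ₂ : ∀ s ∈ Set.Ioc (0 : ℝ) 1, MonotoneOn (fun t => φ s t) (Set.Ioc (0 : ℝ) 1)) :
    ∃ (C c : ℝ) (q₀ : ℕ), 0 < c ∧
      ∀ (F : Type*) [Field F] [Fintype F], ringChar F ≠ 2 → q₀ ≤ Fintype.card F →
      ∀ d : ℕ, 4 ≤ d → ∀ lam : F, lam ≠ 0 →
      ∀ f : (Fin d → F) → ℝ, (∀ x, f x ∈ Set.Icc (-1 : ℝ) 1) →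
      ∃ (Γ : Finset (Fin d → F)) (ρ : ℝ),
        Γ.Nonempty ∧ ρ ∈ Set.Ioc (0 : ℝ) 1 ∧ IsRegular Γ ρ ∧ (Γ.card : ℝ) ≤ C ∧ c ≤ ρ ∧
        ∃ f₁ f₂ f₃ : (Fin d → F) → ℝ,
          (∀ x, f₁ x ∈ Set.Icc (-2 : ℝ) 2) ∧ (∀ x, f₂ x ∈ Set.Icc (-2 : ℝ) 2) ∧
          (∀ x, f₃ x ∈ Set.Icc (-2 : ℝ) 2) ∧
          f = f₁ + f₂ + f₃ ∧
          f₁ = convolve (nu (bohr Γ ρ)) (fun x => f x * sphereMeasure lam x) ∧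
          uPerpNorm lam f₂ ≤ φ ((Γ.card : ℝ)⁻¹) ρ ∧
          l2SphereNorm lam f₃ ≤ η := by
  obtain ⟨hη0, hη1⟩ := hη
  have hφle : ∀ (m n : ℕ) (s t : ℝ), 1 ≤ m → m ≤ n → 0 < s → s ≤ t → t ≤ 1 →
      φ (n : ℝ)⁻¹ s ≤ φ (m : ℝ)⁻¹ t := by
    intro m n s t hm hmn hs hst ht
    have hmI := inv_natCast_mem_Ioc hm
    have hnI := inv_natCast_mem_Ioc (hm.trans hmn)
    have hinv : (n : ℝ)⁻¹ ≤ (m : ℝ)⁻¹ :=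
      inv_anti₀ (by exact_mod_cast hm) (by exact_mod_cast hmn)
    exact (hφ₁ s ⟨hs, hst.trans ht⟩ hnI hmI hinv).trans
      (hφ₂ _ hmI ⟨hs, hst.trans ht⟩ ⟨hs.trans_le hst, ht⟩ hst)
  -- the energies lie in `[0, 4]`, so `64 / η ^ 2` steps contain one that gains at most `η ^ 2 / 16`
  set α := η / 12 with hα
  have hα0 : 0 < α := by positivity
  set J := ⌈64 / η ^ 2⌉₊
  set C := (rankRadius φ α J).1 with hC
  set c := (rankRadius φ α J).2 with hc
  obtain ⟨hC1, hc0, hc1⟩ := rankRadius_mem hφ hα0 J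
  rw [← hC] at hC1
  rw [← hc] at hc0 hc1
  set ω := φ (C : ℝ)⁻¹ c with hω
  obtain ⟨hω0, hω1⟩ := hφ _ (inv_natCast_mem_Ioc hC1) _ ⟨hc0, hc1⟩
  rw [← hω] at hω0 hω1
  set P := (11 / c) ^ (2 * C) with hP
  have h11 : 1 ≤ 11 / c := by rw [le_div_iff₀ hc0]; linarith
  have hP1 : 1 ≤ P := one_le_pow₀ h11
  -- `ω` is the worst uniformity demanded along the chain and `P` bounds all reciprocal densities;
  -- `s` is the amount by which the finer approximation is shrunk and `δ` is the bound for `q κ`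
  set s := ω ^ 2 * η / 128 with hs
  have hs0 : 0 < s := by positivity
  have hω2 : ω ^ 2 ≤ 1 := pow_le_one₀ hω0.le hω1.le
  have hsη : 128 * s ≤ η := by
    have := mul_le_mul_of_nonneg_right hω2 hη0.le
    linarith
  have hsω : 128 * s ≤ ω ^ 2 := by
    have := mul_le_mul_of_nonneg_left hη1.le (sq_nonneg ω)
    linarith
  set δ := s ^ 2 / (128 * P ^ 2) with hδ
  have hδ0 : 0 < δ := by positivity
  have hδP2 : δ * P ^ 2 = s ^ 2 / 128 := by rw [hδ]; field_simp
  have hδP : δ * P ≤ s ^ 2 / 128 := by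
    rw [← hδP2]
    have : P ≤ P ^ 2 := le_self_pow₀ hP1 two_ne_zero
    gcongr
  have hδs : δ ≤ s ^ 2 / 128 := (le_mul_of_one_le_right hδ0.le hP1).trans hδP
  refine ⟨C, c, ⌈3 / δ ^ 4⌉₊, hc0, ?_⟩
  intro F _ _ hF hq d hd lam hlam f hf
  have hq1 : (1 : ℝ) ≤ Fintype.card F := by exact_mod_cast Fintype.card_pos
  have hσ := isPseudorandom_sphereMeasure (d := d) hF hd hlam hδ0
    ((Nat.le_ceil _).trans (by exact_mod_cast hq))
  set κ := δ / Fintype.card F with hκ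
  have hκδ : κ ≤ δ := div_le_self hδ0.le hq1
  have hκ0 : 0 ≤ κ := hσ.nonneg_const
  have hκP : κ * P ≤ s ^ 2 / 128 := (mul_le_mul_of_nonneg_right hκδ (by linarith)).trans hδP
  have hκQ : κ * Fintype.card F = δ := by rw [hκ]; field_simp
  have hs1 : s ≤ 1 := by linarith
  have hss : s ^ 2 ≤ s := by rw [sq]; exact mul_le_of_le_one_left hs0.le hs1
  have hfabs : ∀ x, |f x| ≤ 1 := fun x => abs_le.mpr (hf x)
  have hf2 : 𝔼 x, f x ^ 2 * sphereMeasure lam x ≤ 2 := by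
    have := hσ.expect_mul_le (by linarith) (g := fun x => f x ^ 2) (M := 1)
      (fun x => (sq_le_one_iff_abs_le_one _).mpr (hfabs x)) zero_le_one
    linarith
  have hCJ : ∀ i ≤ J, (rankRadius φ α i).1 ≤ C := fun i hi => monotone_rankRadius_fst hi
  have hcJ : ∀ i ≤ J, c ≤ (rankRadius φ α i).2 := fun i hi => antitone_rankRadius_snd hφ hα0 hi
  have hlev : ∀ i ≤ J, ω ^ 2 / 16 ≤ specLevel φ (rankRadius φ α i) := by
    intro i hi
    obtain ⟨h1, -, h3⟩ := rankRadius_mem hφ hα0 i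
    have := hφle _ _ _ _ h1 (hCJ i hi) hc0 (hcJ i hi) h3
    rw [specLevel]
    gcongr
  obtain ⟨Γ, ρ, hA, hstep, hcard⟩ := hσ.exists_bohr_sequence hf2 hφ hα0 J (fun i hi => by
    have h1 := hlev i hi.le
    have h2 : (ω ^ 2 / 16) ^ 2 ≤ specLevel φ (rankRadius φ α i) ^ 2 := by gcongr
    have h3 : (128 * s) ^ 2 ≤ (ω ^ 2) ^ 2 := by gcongr
    rw [mul_pow] at h3
    rw [div_pow] at h2
    linarith)
  have hρ0 : ∀ i, 0 < ρ i := fun i => (rankRadius_mem hφ hα0 i).2.1.trans_le (hA i).2.2.1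
  have hρ1 : ∀ i, ρ i ≤ 1 := fun i => (hA i).2.2.2
  have hcρ : ∀ i ≤ J, c ≤ ρ i := fun i hi => (hcJ i hi).trans (hA i).2.2.1
  have hPi : ∀ i ≤ J, ∑ ξ, bohrCoeff (Γ i) (ρ i) ξ ^ 2 ≤ P := by
    intro i hi
    rw [sum_bohrCoeff_sq _ (hρ0 i).le]
    refine (card_div_card_bohr_le (Γ i) (hρ0 i) (hρ1 i)).trans ?_
    have h1 : 11 / ρ i ≤ 11 / c := div_le_div_of_nonneg_left (by norm_num) hc0 (hcρ i hi)
    have h2 := (hcard i hi).trans (hCJ i hi)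
    have h3 := hρ0 i
    calc _ ≤ (11 / c) ^ (2 * (Γ i).card) := by gcongr
      _ ≤ _ := pow_le_pow_right₀ h11 (by omega)
  obtain ⟨i, hi, hD⟩ := hσ.exists_small_increment hf2 (P := P) hα0 hη0 (by rw [hα]; ring)
    (Nat.le_ceil _) (fun i => ⟨(hρ0 i).le, hρ1 i⟩) hPi (by linarith)
    (fun i => ⟨(hstep i).2.1, (hstep i).2.2.2⟩)
  obtain ⟨f₂, f₃, hb2, hb3, hdec, hU, hL⟩ := hσ.exists_decomposition (sphereMeasure_le lam) hfabs
    (hρ0 i).le (hρ0 (i + 1)).le (hρ1 (i + 1)) (hPi i hi.le) (hPi (i + 1) hi) (by linarith)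
    hs0.le hs1 (by linarith) (hstep i).2.2.1 (hstep i).1 hD
  have hcardi : 1 ≤ (Γ i).card := (hA i).1.card_pos
  refine ⟨Γ i, ρ i, (hA i).1, ⟨hρ0 i, hρ1 i⟩, (hA i).2.1, ?_, hcρ i hi.le, _, f₂, f₃, fun x => ?_,
    fun x => abs_le.mp (hb2 x), fun x => abs_le.mp (hb3 x), hdec, rfl, ?_, ?_⟩
  · exact_mod_cast (hcard i hi.le).trans (hCJ i hi.le)
  · exact abs_le.mp ((hσ.abs_convolve_nu_le hfabs (hρ0 i).le (hPi i hi.le) x).trans (by linarith))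
  · obtain ⟨h1, h2, h3⟩ := rankRadius_mem hφ hα0 i
    set ψ := φ ((rankRadius φ α i).1 : ℝ)⁻¹ (rankRadius φ α i).2 with hψ
    have hψ0 : 0 < ψ := (hφ _ (inv_natCast_mem_Ioc h1) _ ⟨h2, h3⟩).1
    have hψω : ω ≤ ψ := hφle _ _ _ _ h1 (hCJ i hi.le) hc0 (hcJ i hi.le) h3
    have hψle : ψ ≤ φ ((Γ i).card : ℝ)⁻¹ (ρ i) :=
      hφle _ _ _ _ hcardi (hcard i hi.le) h2 (hA i).2.2.1 (hρ1 i)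
    refine (uPerpNorm_le hψ0.le (hU.trans ?_)).trans hψle
    have hω2ψ : ω ^ 2 ≤ ψ ^ 2 := by gcongr
    have hθ : specLevel φ (rankRadius φ α i) + 2 * (κ * P) + 4 * s ≤ ψ ^ 2 / 8 := by
      rw [specLevel, ← hψ]
      linarith
    have hθ0 : 0 ≤ specLevel φ (rankRadius φ α i) + 2 * (κ * P) + 4 * s := by
      rw [specLevel]
      positivity
    have hδψ : 128 * δ ≤ (ψ ^ 2) ^ 2 / 2 := by
      have h4 : (128 * s) ^ 2 ≤ (ψ ^ 2) ^ 2 := by gcongr; linarith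
      rw [mul_pow] at h4
      have := sq_nonneg (ψ ^ 2)
      linarith
    rw [hκQ]
    calc _ ≤ 16 * (ψ ^ 2 / 8) ^ 2 + (ψ ^ 2) ^ 2 / 2 := by gcongr
      _ = 3 / 4 * ψ ^ 4 := by ring
      _ ≤ ψ ^ 4 := by linarith [pow_pos hψ0 4]
  · rw [l2SphereNorm]
    refine Real.sqrt_le_iff.mpr ⟨hη0.le, hL.trans ?_⟩
    have h1 : κ * P ^ 2 ≤ s ^ 2 / 128 := by
      rw [← hδP2]; gcongr
    have h2 : (128 * s) ^ 2 ≤ η ^ 2 := by gcongr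
    rw [mul_pow] at h2
    calc 2 * (η ^ 2 / 8 + κ * (4 * P) ^ 2) + 16 * s ^ 2
        = η ^ 2 / 4 + 32 * (κ * P ^ 2) + 16 * s ^ 2 := by ring
      _ ≤ η ^ 2 := by linarith [sq_nonneg η]
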